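/- Notation. Let $d\ge 1$, $0<\beta\le 1$, $a>0$, $b\in\mathbb R$, let $\Omega$ be a compact subset of some $\mathbb R^N$ and let $\Psi=\{\psi_{\mathbf k}\}_{\mathbf k\in\mathbb Z^d}$ be a system of continuous functions $\psi_{\mathbf k}:\Omega\to\mathbb C$. For $\mathbf s\in\mathbb N_0^d$ put $\rho(\mathbf s):=\{\mathbf k\in\mathbb Z^d : [2^{s_i-1}]\le |k_i|<2^{s_i},\ i=1,\dots,d\}$. The class $\mathbf W^{a,b}_{A_\beta}(\Psi)$ consists of all $f$ that have an admissible representation, that is, $$f=\sum_{\mathbf k}a_{\mathbf k}\psi_{\mathbf k},\quad \sum_{\mathbf k}|a_{\mathbf k}|<\infty,\quad \Big(\sum_{\|\mathbf s\|_1=j}\ \sum_{\mathbf k\in\rho(\mathbf s)}|a_{\mathbf k}|^\beta\Big)^{1/\beta}\le 2^{-aj}\max(j,1)^{(d-1)b}\quad (j=0,1,2,\dots).$$ For a probability measure $\mu$ on $\Omega$ and a set $\xi=\{\xi^1,\dots,\xi^m\}\subset\Omega$, $m\ge 1$, let $\mu_\xi:=\frac12\big(\mu+\frac1m\sum_{j=1}^m\delta_{\xi^j}\big)$.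 A greedy-based method in $L_p(\Omega,\mu_\xi)$ is given by finitely many pairwise disjoint finite blocks $\Lambda_1,\dots,\Lambda_J\subset\mathbb Z^d$ and numbers $n_i,m_i\in\mathbb N_0$, none of which depends on $f$. From a representation $f=\sum_{\mathbf k} a_{\mathbf k}\psi_{\mathbf k}$ it produces in each block the terms $a_{\mathbf k}\psi_{\mathbf k}$ at $\min(n_i,|\Lambda_i|)$ indices $\mathbf k\in\Lambda_i$ with the largest $|a_{\mathbf k}|$, and the approximant obtained after $m_i$ iterations of the Weak Chebyshev Greedy Algorithm (with weakness parameter $1$, in the complex space $L_p(\Omega,\mu_\xi)$, with respect to $\{\psi_{\mathbf k}\}_{\mathbf k\in\Lambda_i}$) from the sum of the remaining terms of the block; its output is the sum of all these. An iteration of that algorithm for an element $g$ with current approximant $G$ (initially $0$) takes a norming functional $F$ of $g-G$ (so $\|F\|=1$, $F(g-G)=\|g-G\|$) and an index $\mathbf k\in\Lambda_i$ maximizing $|F(\psi_{\mathbf k})|$, and replaces $G$ by a best approximant of $g$ from the complex span of all $\psi_{\mathbf k}$ chosen so far. Lemma 5.2. Let $1<p<\infty$, $0<\beta\le1$, $a>0$,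 $b\in\mathbb R$, $d\ge1$, and $p^*:=\min(p,2)$. There are constants $c^*=c^*(a,\beta,d,p)>0$ and $C=C(a,b,\beta,d,p)>0$ such that the following holds for every $\Omega$ and $\Psi$ as above with $|\psi_{\mathbf k}(\mathbf x)|\le 1$ for all $\mathbf x\in\Omega$, $\mathbf k\in\mathbb Z^d$, and every $v\in\mathbb N$, $v\ge1$. There is a finite set $Q\subset\mathbb Z^d$ with $|Q|\le v^{c^*}$ such that for every Borel probability measure $\mu$ on $\Omega$ and every nonempty finite $\xi\subset\Omega$ there is a greedy-based method in $L_p(\Omega,\mu_\xi)$ with the following property. For every $f\in\mathbf W^{a,b}_{A_\beta}(\Psi)$ and each of its admissible representations, the method can be carried out, and every output $A_{v,\xi}(f)$ of it (whatever choices are made where they are not unique) is a linear combination of at most $v$ of the functions $\psi_{\mathbf k}$, $\mathbf k\in Q$, and satisfies $$\|f-A_{v,\xi}(f)\|_{L_p(\Omega,\mu_\xi)}\le C\,v^{-a+1/p^*-1/\beta}\,(\log(2v))^{(d-1)(a+b)}.$$ -/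

import Mathlib

open MeasureTheory
open scoped ENNReal

noncomputable section

/-- The dyadic block `ρ(s)`: all `k ∈ ℤ^d` with `[2^(s_i - 1)] ≤ |k_i| < 2^(s_i)` for every `i`.
The integer quotient `2 ^ s / 2` is the integer part of `2^(s-1)`, also for `s = 0`. -/
def dyadicBlock {d : ℕ} (s : Fin d → ℕ) : Finset (Fin d → ℤ) :=
  Fintype.piFinset fun i =>
    (Finset.Ioo (-(2 : ℤ) ^ s i) ((2 : ℤ) ^ s i)).filter fun k => (2 : ℤ) ^ s i / 2 ≤ |k|

/-- The hyperbolic layer: the union of the dyadic blocks `ρ(s)` over `s ∈ ℕ₀^d` with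
`‖s‖₁ = j`. -/
def hyperbolicLayer (d j : ℕ) : Finset (Fin d → ℤ) :=
  (Finset.piAntidiag Finset.univ j).biUnion dyadicBlock

/-- `c` is a family of coefficients of an absolutely convergent representation
`f = ∑ c_k ψ_k` for which the pieces `f_j` of `f` over the hyperbolic layers satisfy
`|f_j|_{A_β} = (∑ |c_k|^β)^(1/β) ≤ 2^(-a j) max(j,1)^((d-1) b)`. -/
structure IsWRepresentation {d : ℕ} {Ω : Type*} [TopologicalSpace Ω] [CompactSpace Ω]
    (a b β : ℝ) (ψ : (Fin d → ℤ) → C(Ω, ℂ)) (f : C(Ω, ℂ)) (c : (Fin d → ℤ) → ℂ) : Prop where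
  summable : Summable fun k => ‖c k‖
  hasSum : HasSum (fun k => c k • ψ k) f
  layer_le : ∀ j : ℕ, (∑ k ∈ hyperbolicLayer d j, ‖c k‖ ^ β) ^ (1 / β) ≤
    (2 : ℝ) ^ (-a * (j : ℝ)) * (max (j : ℝ) 1) ^ (((d : ℝ) - 1) * b)

/-- The class `W^{a,b}_{A_β}(Ψ)`. -/
def WClass {d : ℕ} {Ω : Type*} [TopologicalSpace Ω] [CompactSpace Ω]
    (a b β : ℝ) (ψ : (Fin d → ℤ) → C(Ω, ℂ)) : Set C(Ω, ℂ) :=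
  {f | ∃ c, IsWRepresentation a b β ψ f c}

/-- The measure `μ_ξ = (μ + m⁻¹ ∑ δ_{ξ^j}) / 2`. -/
def measureXi {Ω : Type*} [MeasurableSpace Ω] (μ : Measure Ω) {m : ℕ} (ξ : Fin m → Ω) :
    Measure Ω :=
  (2 : ℝ≥0∞)⁻¹ • (μ + (m : ℝ≥0∞)⁻¹ • ∑ j, Measure.dirac (ξ j))

instance {Ω : Type*} [MeasurableSpace Ω] (μ : Measure Ω) [IsFiniteMeasure μ] {m : ℕ}
    (ξ : Fin m → Ω) : IsFiniteMeasure (measureXi μ ξ) := by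
  refine ⟨?_⟩
  rcases Nat.eq_zero_or_pos m with rfl | hm
  · simp [measureXi, ENNReal.mul_lt_top_iff]
  · simp only [measureXi, Measure.smul_apply, Measure.add_apply, Measure.finsetSum_apply,
      smul_eq_mul]
    refine ENNReal.mul_lt_top (by simp) (ENNReal.add_lt_top.2 ⟨measure_lt_top _ _, ?_⟩)
    refine ENNReal.mul_lt_top ?_ (by simp)
    simp [ENNReal.inv_lt_top, hm]

/-- `h` is the coefficient vector of the `m`-th approximant of some realization of the Weak
Chebyshev Greedy Algorithm with weakness parameter `t` in the complex Banach space `X`, applied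
to `f` with respect to the dictionary `{g_k : k ∈ Λ}`. At step `i` (counted from `0`), `F i` is
a norming functional of the residual `f - G i`, the element `g_(φ i)` is a greedy choice for
it, and `G (i + 1)` is a best approximant of `f` from the span of
`g_(φ 0), …, g_(φ i)`. -/
def IsWCGAOutput {ι X : Type*} [NormedAddCommGroup X] [NormedSpace ℂ X] (t : ℝ) (g : ι → X)
    (Λ : Finset ι) (f : X) (m : ℕ) (h : ι →₀ ℂ) : Prop :=
  ∃ (φ : ℕ → ι) (F : ℕ → StrongDual ℂ X) (G : ℕ → ι →₀ ℂ),
    G 0 = 0 ∧ G m = h ∧ ∀ i < m,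
      (‖F i‖ = 1 ∧
        F i (f - Finsupp.linearCombination ℂ g (G i)) =
          (‖f - Finsupp.linearCombination ℂ g (G i)‖ : ℂ)) ∧
      (φ i ∈ Λ ∧ ∀ k ∈ Λ, t * ‖F i (g k)‖ ≤ ‖F i (g (φ i))‖) ∧
      (G (i + 1) ∈ Finsupp.supported ℂ ℂ (φ '' Set.Iic i) ∧
        ∀ h' ∈ Finsupp.supported ℂ ℂ (φ '' Set.Iic i),
          ‖f - Finsupp.linearCombination ℂ g (G (i + 1))‖ ≤
            ‖f - Finsupp.linearCombination ℂ g h'‖)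

/-- `I` consists of `n` indices from `Λ` (of all of `Λ`, if `Λ` has fewer than `n` elements) at
which the coefficients `c` are largest in absolute value. -/
def IsLargestSelection {ι : Type*} (c : ι → ℂ) (Λ : Finset ι) (n : ℕ) (I : Finset ι) : Prop :=
  I ⊆ Λ ∧ I.card = min n Λ.card ∧ ∀ k ∈ I, ∀ l ∈ Λ, l ∉ I → ‖c l‖ ≤ ‖c k‖

/-- The parameters of a greedy-based method: finitely many pairwise disjoint finite blocks of
indices and, for each block, the number `select j` of largest coefficients to keep and the
number `iterate j` of iterations of the Weak Chebyshev Greedy Algorithm. -/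
structure GreedyScheme (ι : Type*) where
  num : ℕ
  block : Fin num → Finset ι
  disjoint : Pairwise fun i j => Disjoint (block i) (block j)
  select : Fin num → ℕ
  iterate : Fin num → ℕ

/-- `h` is the coefficient vector of an approximant which the scheme `S` produces in `L_p(ν)`
from the coefficients `c`. In every block one keeps the terms `c_k ψ_k` with the largest
coefficients, applies the Weak Chebyshev Greedy Algorithm (with weakness parameter `1`) in
`L_p(ν)`, with respect to the `ψ_k` of the block, to the sum of the other terms of the block,
and one adds up everything obtained. -/
def GreedyScheme.IsOutput {ι Ω : Type*} [DecidableEq ι] [TopologicalSpace Ω] [CompactSpace Ω]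
    [MeasurableSpace Ω] [BorelSpace Ω] (S : GreedyScheme ι) (p : ℝ≥0∞) [Fact (1 ≤ p)]
    (ν : Measure Ω) [IsFiniteMeasure ν] (ψ : ι → C(Ω, ℂ)) (c : ι → ℂ) (h : ι →₀ ℂ) : Prop :=
  ∃ (I : Fin S.num → Finset ι) (G : Fin S.num → ι →₀ ℂ),
    (∀ j, IsLargestSelection c (S.block j) (S.select j) (I j) ∧
      IsWCGAOutput 1 (fun k => ContinuousMap.toLp p ν ℂ (ψ k)) (S.block j)
        (ContinuousMap.toLp p ν ℂ (∑ k ∈ S.block j \ I j, c k • ψ k)) (S.iterate j) (G j)) ∧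
    h = ∑ j, (Finsupp.indicator (I j) (fun k _ => c k) + G j)

end

/-
For `1 < p < ∞` the space `L_p` is uniformly smooth of power `q = min(p, 2)`, so `n` steps of the
greedy algorithm reduce the `ℓ₁`-size `A` of the coefficients to a norm of order `A n^(1/q - 1)`.
By Stechkin's inequality the coefficients outside the `n` largest ones have `ℓ₁`-size at most
`n^(1 - 1/β)` times their `ℓ_β`-quasinorm; together a block is approximated by `2n` terms with an
error of order `n^(1/q - 1/β)`.

Put `θ = 1/β - 1/q > 0`. The hyperbolic layers below a level `N` with `2^N N^(d-1) ≍ v` are kept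
completely, and the layer `N + l` gets the budget `u r^l` with `u ≍ v` and `r < 1` so close to `1`
that `r^(-θ) 2^(-a) < 1`: then both the budgets and the errors `(u r^l)^(-θ) 2^(-a(N + l))` decay
geometrically. The budget vanishes after `O(log v)` layers, which makes `Q` polynomial in `v`, and
the triangle inequality suffices for the coefficients beyond.
-/

section TwoPoint

theorem one_add_rpow_add_one_sub_rpow_le {r z : ℝ} (hr : 0 ≤ r) (hz : |z| ≤ 1) :
    (1 + z) ^ r + (1 - z) ^ r ≤ 2 * (1 + r / 2 * Real.exp (r / 2) * z ^ 2) ^ r := by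
  have le_exp : ∀ x : ℝ, |x| ≤ 1 → (1 + x) ^ r ≤ Real.exp (r * x) := fun x hx => by
    rw [mul_comm, Real.exp_mul]
    exact Real.rpow_le_rpow (by linarith [(abs_le.1 hx).1]) (by linarith [Real.add_one_le_exp x]) hr
  have hsum : (1 + z) ^ r + (1 - z) ^ r ≤ Real.exp (r * z) + Real.exp (-(r * z)) := by
    have h := le_exp (-z) (by rwa [abs_neg])
    rw [mul_neg, ← sub_eq_add_neg] at h
    exact add_le_add (le_exp z hz) h
  have hcosh : Real.exp (r * z) + Real.exp (-(r * z)) ≤ 2 * Real.exp (r / 2 * z ^ 2) ^ r := by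
    have h := Real.cosh_le_exp_half_sq (r * z)
    rw [Real.cosh_eq] at h
    rw [← Real.exp_mul, show r / 2 * z ^ 2 * r = (r * z) ^ 2 / 2 by ring]
    linarith
  have hexp : Real.exp (r / 2 * z ^ 2) ≤ 1 + r / 2 * Real.exp (r / 2) * z ^ 2 := by
    have hz2 : z ^ 2 ≤ 1 := (sq_le_one_iff_abs_le_one z).2 hz
    have hmono : Real.exp (r / 2 * z ^ 2) ≤ Real.exp (r / 2) :=
      Real.exp_le_exp.2 (mul_le_of_le_one_right (by positivity) hz2)
    -- `exp u - 1 ≤ u * exp u`, which is `1 - u ≤ exp (-u)` multiplied by `exp u`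
    have h := mul_le_mul_of_nonneg_left (Real.add_one_le_exp (-(r / 2 * z ^ 2)))
      (Real.exp_pos (r / 2 * z ^ 2)).le
    rw [← Real.exp_add, add_neg_cancel, Real.exp_zero] at h
    nlinarith [mul_le_mul_of_nonneg_left hmono (show 0 ≤ r / 2 * z ^ 2 by positivity)]
  have := Real.rpow_le_rpow (Real.exp_pos _).le hexp hr
  linarith

theorem norm_rpow_eq_sq_rpow {E : Type*} [SeminormedAddCommGroup E] (p : ℝ) (x : E) :
    ‖x‖ ^ p = (‖x‖ ^ 2) ^ (p / 2) := by
  rw [← Real.rpow_natCast_mul (norm_nonneg x)]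
  congr 1
  push_cast
  ring

variable {E : Type*} [NormedAddCommGroup E] [InnerProductSpace ℝ E]

theorem norm_add_rpow_add_norm_sub_rpow_le_of_two_le {p : ℝ} (hp : 2 ≤ p) (x y : E) :
    ‖x + y‖ ^ p + ‖x - y‖ ^ p ≤
      2 * (‖x‖ ^ 2 + (1 + p * Real.exp (p / 4)) * ‖y‖ ^ 2) ^ (p / 2) := by
  rcases eq_or_ne y 0 with rfl | hy
  · rw [add_zero, sub_zero, norm_zero, norm_rpow_eq_sq_rpow]
    norm_num
    linarith
  set s := ‖x‖ ^ 2 + ‖y‖ ^ 2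
  set z := 2 * inner ℝ x y / s
  have hs : 0 < s := by positivity
  have hsz : s * z = 2 * inner ℝ x y := mul_div_cancel₀ _ hs.ne'
  have hadd : ‖x + y‖ ^ 2 = s * (1 + z) := by
    rw [mul_add, hsz, norm_add_sq_real]; ring
  have hsub : ‖x - y‖ ^ 2 = s * (1 - z) := by
    rw [mul_sub, hsz, norm_sub_sq_real]; ring
  have hz : |z| ≤ 1 := abs_le.2
    ⟨by linarith [(mul_nonneg_iff_of_pos_left hs).1 (hadd ▸ sq_nonneg ‖x + y‖)],
      by linarith [(mul_nonneg_iff_of_pos_left hs).1 (hsub ▸ sq_nonneg ‖x - y‖)]⟩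
  have hz2 : s * z ^ 2 ≤ 4 * ‖y‖ ^ 2 := by
    have hinner : (inner ℝ x y) ^ 2 ≤ (‖x‖ * ‖y‖) ^ 2 :=
      sq_le_sq.2 ((abs_real_inner_le_norm x y).trans (le_abs_self _))
    refine le_of_mul_le_mul_left ?_ hs
    calc s * (s * z ^ 2)
        = 4 * (inner ℝ x y) ^ 2 := by linear_combination (s * z + 2 * inner ℝ x y) * hsz
      _ ≤ s * (4 * ‖y‖ ^ 2) := by nlinarith [sq_nonneg (‖y‖ ^ 2)]
  calc ‖x + y‖ ^ p + ‖x - y‖ ^ p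
      = s ^ (p / 2) * ((1 + z) ^ (p / 2) + (1 - z) ^ (p / 2)) := by
        rw [norm_rpow_eq_sq_rpow, norm_rpow_eq_sq_rpow _ (x - y), hadd, hsub,
          Real.mul_rpow hs.le (by linarith [(abs_le.1 hz).1]),
          Real.mul_rpow hs.le (by linarith [(abs_le.1 hz).2]), mul_add]
    _ ≤ s ^ (p / 2) * (2 * (1 + p / 2 / 2 * Real.exp (p / 2 / 2) * z ^ 2) ^ (p / 2)) := by
        gcongr
        exact one_add_rpow_add_one_sub_rpow_le (by linarith) hz
    _ = 2 * (s * (1 + p / 4 * Real.exp (p / 4) * z ^ 2)) ^ (p / 2) := by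
        rw [Real.mul_rpow hs.le (by positivity)]
        ring_nf
    _ ≤ 2 * (‖x‖ ^ 2 + (1 + p * Real.exp (p / 4)) * ‖y‖ ^ 2) ^ (p / 2) := by
        gcongr
        have := mul_le_mul_of_nonneg_left hz2 (show 0 ≤ p / 4 * Real.exp (p / 4) by positivity)
        linarith

theorem norm_add_rpow_add_norm_sub_rpow_le_of_le_two {p : ℝ} (hp : 0 ≤ p) (hp2 : p ≤ 2)
    (x y : E) : ‖x + y‖ ^ p + ‖x - y‖ ^ p ≤ 2 * ‖x‖ ^ p + 2 * ‖y‖ ^ p := by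
  have hconc := (Real.concaveOn_rpow (p := p / 2) (by linarith) (by linarith)).2
    (Set.mem_Ici.2 (sq_nonneg ‖x + y‖)) (Set.mem_Ici.2 (sq_nonneg ‖x - y‖))
    one_half_pos.le one_half_pos.le (add_halves 1)
  have hmid : (1 / 2 : ℝ) • ‖x + y‖ ^ 2 + (1 / 2 : ℝ) • ‖x - y‖ ^ 2 = ‖x‖ ^ 2 + ‖y‖ ^ 2 := by
    simp only [smul_eq_mul]
    linarith [parallelogram_law_with_norm ℝ x y]
  have hsub := Real.rpow_add_le_add_rpow (sq_nonneg ‖x‖) (sq_nonneg ‖y‖)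
    (p := p / 2) (by linarith) (by linarith)
  rw [hmid] at hconc
  simp only [smul_eq_mul, ← norm_rpow_eq_sq_rpow] at hconc hsub
  linarith

end TwoPoint

/-- `X` is uniformly smooth of power type `q` with constant `K`, in its two-point form, which is
equivalent to a bound `O(t ^ q)` for the modulus of smoothness. -/
def IsPowerSmooth (q K : ℝ) (X : Type*) [NormedAddCommGroup X] : Prop :=
  ∀ x y : X, ‖x + y‖ ^ q + ‖x - y‖ ^ q ≤ 2 * ‖x‖ ^ q + K * ‖y‖ ^ q

/-- A constant with which the spaces `L_p`, `1 ≤ p < ∞`, are uniformly smooth of power type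
`min p 2`. -/
noncomputable def smoothnessConst (p : ℝ) : ℝ :=
  2 * (1 + p * Real.exp (p / 4))

theorem two_le_smoothnessConst {p : ℝ} (hp : 0 ≤ p) : 2 ≤ smoothnessConst p := by
  have : 0 ≤ p * Real.exp (p / 4) := by positivity
  unfold smoothnessConst
  linarith

section Lp

variable {α E : Type*} [MeasurableSpace α] {ν : Measure α} [NormedAddCommGroup E] {p : ℝ≥0∞}

theorem exists_Lp_eq_norm_sq (x : Lp E p ν) :
    ∃ U : Lp ℝ (p / 2) ν, (U =ᵐ[ν] fun a => ‖x a‖ ^ 2) ∧ ‖U‖ = ‖x‖ ^ 2 := by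
  have hmem : MemLp (fun a => ‖x a‖ ^ (2 : ℝ)) (p / 2) ν := by
    simpa using (Lp.memLp x).norm_rpow_div 2
  refine ⟨hmem.toLp _, ?_, ?_⟩
  · simpa only [Real.rpow_two] using hmem.coeFn_toLp
  · rw [Lp.norm_toLp, eLpNorm_norm_rpow _ two_pos, ENNReal.ofReal_ofNat,
      ENNReal.div_mul_cancel two_ne_zero ENNReal.ofNat_ne_top, ← ENNReal.toReal_rpow,
      Real.rpow_two, Lp.norm_def]

variable [Fact (1 ≤ p)]

theorem Lp_norm_rpow_eq_integral (hp : p ≠ ∞) (x : Lp E p ν) :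
    ‖x‖ ^ p.toReal = ∫ a, ‖x a‖ ^ p.toReal ∂ν := by
  have h0 : p ≠ 0 := (zero_lt_one.trans_le Fact.out).ne'
  have hP : p.toReal ≠ 0 := (ENNReal.toReal_pos h0 hp).ne'
  rw [Lp.norm_def, (Lp.memLp x).eLpNorm_eq_integral_rpow_norm h0 hp,
    ENNReal.toReal_ofReal (by positivity), Real.rpow_inv_rpow (by positivity) hP]

theorem Lp_integrable_norm_rpow (hp : p ≠ ∞) (x : Lp E p ν) :
    Integrable (fun a => ‖x a‖ ^ p.toReal) ν :=
  (Lp.memLp x).integrable_norm_rpow (zero_lt_one.trans_le Fact.out).ne' hp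

theorem Lp_norm_add_rpow_add_norm_sub_rpow_le (hp : p ≠ ∞) {x y : Lp E p ν} {φ : α → ℝ}
    (hφ : Integrable φ ν)
    (h : ∀ᵐ a ∂ν, ‖x a + y a‖ ^ p.toReal + ‖x a - y a‖ ^ p.toReal ≤ φ a) :
    ‖x + y‖ ^ p.toReal + ‖x - y‖ ^ p.toReal ≤ ∫ a, φ a ∂ν := by
  have hadd := Lp_integrable_norm_rpow hp (x + y)
  have hsub := Lp_integrable_norm_rpow hp (x - y)
  rw [Lp_norm_rpow_eq_integral hp, Lp_norm_rpow_eq_integral hp, ← integral_add hadd hsub]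
  refine integral_mono_ae (hadd.add hsub) hφ ?_
  filter_upwards [h, Lp.coeFn_add x y, Lp.coeFn_sub x y] with a ha h1 h2
  rwa [h1, h2]

variable [InnerProductSpace ℝ E]

theorem isPowerSmooth_Lp_of_le_two (hp : p.toReal ≤ 2) (hp' : p ≠ ∞) :
    IsPowerSmooth p.toReal 2 (Lp E p ν) := fun x y => by
  have hx := (Lp_integrable_norm_rpow hp' x).const_mul 2
  have hy := (Lp_integrable_norm_rpow hp' y).const_mul 2
  rw [Lp_norm_rpow_eq_integral hp' x, Lp_norm_rpow_eq_integral hp' y, ← integral_const_mul,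
    ← integral_const_mul, ← integral_add hx hy]
  exact Lp_norm_add_rpow_add_norm_sub_rpow_le hp' (hx.add hy) (.of_forall fun a =>
    norm_add_rpow_add_norm_sub_rpow_le_of_le_two ENNReal.toReal_nonneg hp (x a) (y a))

theorem isPowerSmooth_Lp_of_two_le (hp : 2 ≤ p) (hp' : p ≠ ∞) :
    IsPowerSmooth 2 (smoothnessConst p.toReal) (Lp E p ν) := fun x y => by
  set P := p.toReal
  set K := 1 + P * Real.exp (P / 4)
  have hP2 : 2 ≤ P := ENNReal.toReal_mono hp' hp
  have hhalf : (p / 2).toReal = P / 2 := by rw [ENNReal.toReal_div, ENNReal.toReal_ofNat]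
  have hfin : p / 2 ≠ ∞ := ENNReal.div_ne_top hp' two_ne_zero
  have : Fact (1 ≤ p / 2) :=
    ⟨by rwa [ENNReal.le_div_iff_mul_le (by simp) (by simp), one_mul]⟩
  obtain ⟨U, hU, hUx⟩ := exists_Lp_eq_norm_sq x
  obtain ⟨W, hW, hWy⟩ := exists_Lp_eq_norm_sq y
  have hint := (Lp_integrable_norm_rpow hfin (U + K • W)).const_mul 2
  have hLp : ‖x + y‖ ^ P + ‖x - y‖ ^ P ≤ 2 * ‖U + K • W‖ ^ (P / 2) := by
    rw [← hhalf, Lp_norm_rpow_eq_integral hfin, ← integral_const_mul]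
    refine Lp_norm_add_rpow_add_norm_sub_rpow_le hp' hint ?_
    filter_upwards [hU, hW, Lp.coeFn_add U (K • W), Lp.coeFn_smul K W] with a h1 h2 h3 h4
    rw [h3, Pi.add_apply, h4, Pi.smul_apply, h1, h2, smul_eq_mul, hhalf,
      Real.norm_of_nonneg (by positivity)]
    exact norm_add_rpow_add_norm_sub_rpow_le_of_two_le hP2 (x a) (y a)
  have hMinkowski : ‖U + K • W‖ ≤ ‖x‖ ^ 2 + K * ‖y‖ ^ 2 := by
    refine (norm_add_le _ _).trans_eq ?_
    rw [norm_smul, hUx, hWy, Real.norm_of_nonneg (by positivity)]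
  have hconv := (convexOn_rpow (p := P / 2) (by linarith)).2
    (Set.mem_Ici.2 (sq_nonneg ‖x + y‖)) (Set.mem_Ici.2 (sq_nonneg ‖x - y‖))
    one_half_pos.le one_half_pos.le (add_halves 1)
  simp only [smul_eq_mul, ← norm_rpow_eq_sq_rpow] at hconv
  have hle : (1 / 2 * ‖x + y‖ ^ 2 + 1 / 2 * ‖x - y‖ ^ 2) ^ (P / 2) ≤
      (‖x‖ ^ 2 + K * ‖y‖ ^ 2) ^ (P / 2) := by
    have := Real.rpow_le_rpow (norm_nonneg _) hMinkowski (show 0 ≤ P / 2 by linarith)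
    linarith
  rw [Real.rpow_le_rpow_iff (by positivity) (by positivity) (by linarith)] at hle
  simp only [Real.rpow_two, smoothnessConst]
  linarith

theorem isPowerSmooth_Lp (hp : p ≠ ∞) :
    IsPowerSmooth (min p.toReal 2) (smoothnessConst p.toReal) (Lp E p ν) := by
  rcases le_total p 2 with h | h
  · have hP : p.toReal ≤ 2 := ENNReal.toReal_mono ENNReal.ofNat_ne_top h
    rw [min_eq_left hP]
    exact fun x y => (isPowerSmooth_Lp_of_le_two hP hp x y).trans
      (by gcongr; exact two_le_smoothnessConst ENNReal.toReal_nonneg)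
  · have hP : 2 ≤ p.toReal := ENNReal.toReal_mono hp h
    rw [min_eq_right hP]
    exact isPowerSmooth_Lp_of_two_le h hp

end Lp

section NormingFunctional

theorem rpow_add_mul_le_add_rpow {q s t : ℝ} (hq : 1 < q) (hs : 0 ≤ s) (ht : 0 ≤ t) :
    s ^ q + q * s ^ (q - 1) * t ≤ (s + t) ^ q := by
  rcases hs.eq_or_lt with rfl | hs
  · rw [Real.zero_rpow (by linarith), Real.zero_rpow (by linarith)]
    simpa only [mul_zero, zero_mul, add_zero, zero_add] using Real.rpow_nonneg ht q
  have hts : 0 ≤ t / s := by positivity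
  calc s ^ q + q * s ^ (q - 1) * t = s ^ q * (1 + q * (t / s)) := by
        rw [Real.rpow_sub_one hs.ne']; ring
    _ ≤ s ^ q * (1 + t / s) ^ q := by
        gcongr
        exact one_add_mul_self_le_rpow_one_add (by linarith) hq.le
    _ = (s + t) ^ q := by
        rw [← Real.mul_rpow hs.le (by positivity), mul_add, mul_one, mul_div_cancel₀ _ hs.ne']

variable {𝕜 X : Type*} [RCLike 𝕜] [NormedAddCommGroup X] [NormedSpace 𝕜 X] {q K : ℝ} {x : X}
  {F : StrongDual 𝕜 X}

theorem IsPowerSmooth.exists_norm_sub_smul_rpow_le (hX : IsPowerSmooth q K X) (hq : 1 < q)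
    (hF : ‖F‖ ≤ 1) (hFx : F x = (‖x‖ : 𝕜)) (y : X) {l : ℝ} (hl : 0 ≤ l) :
    ∃ z : 𝕜, ‖x - z • y‖ ^ q ≤
      ‖x‖ ^ q - q * ‖x‖ ^ (q - 1) * (l * ‖F y‖) + K * (l * ‖y‖) ^ q := by
  obtain ⟨w, hw, hwF⟩ := RCLike.exists_norm_eq_mul_self (F y)
  refine ⟨l * w, ?_⟩
  have hnorm : ‖((l : 𝕜) * w) • y‖ = l * ‖y‖ := by
    rw [norm_smul, norm_mul, hw, RCLike.norm_ofReal, abs_of_nonneg hl, mul_one]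
  have hlower : ‖x‖ + l * ‖F y‖ ≤ ‖x + ((l : 𝕜) * w) • y‖ := by
    have hFz : F (x + ((l : 𝕜) * w) • y) = ((‖x‖ + l * ‖F y‖ : ℝ) : 𝕜) := by
      rw [map_add, map_smul, smul_eq_mul, mul_assoc, ← hwF, hFx]
      push_cast
      rfl
    have h := F.le_of_opNorm_le hF (x + ((l : 𝕜) * w) • y)
    rwa [hFz, RCLike.norm_ofReal, abs_of_nonneg (by positivity), one_mul] at h
  have htangent := (rpow_add_mul_le_add_rpow hq (norm_nonneg x)
    (show 0 ≤ l * ‖F y‖ by positivity)).trans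
    (Real.rpow_le_rpow (by positivity) hlower (by linarith))
  have hsmooth := hX x (((l : 𝕜) * w) • y)
  rw [hnorm] at hsmooth
  linarith

/-- A best approximant from a line leaves a residual whose norming functionals vanish on it. -/
theorem IsPowerSmooth.norming_apply_eq_zero (hX : IsPowerSmooth q K X) (hq : 1 < q) (hx : x ≠ 0)
    (hF : ‖F‖ ≤ 1) (hFx : F x = (‖x‖ : 𝕜)) {y : X} (hy : ∀ z : 𝕜, ‖x‖ ≤ ‖x - z • y‖) :
    F y = 0 := by
  have hx0 := norm_pos_iff.2 hx
  have key : ∀ l : ℝ, 0 < l → q * ‖x‖ ^ (q - 1) * ‖F y‖ ≤ K * ‖y‖ ^ q * l ^ (q - 1) :=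
      fun l hl => by
    obtain ⟨z, hz⟩ := hX.exists_norm_sub_smul_rpow_le hq hF hFx y hl.le
    have hle := Real.rpow_le_rpow hx0.le (hy z) (by linarith : 0 ≤ q)
    rw [Real.mul_rpow hl.le (norm_nonneg y)] at hz
    refine le_of_mul_le_mul_left ?_ hl
    calc l * (q * ‖x‖ ^ (q - 1) * ‖F y‖) ≤ K * (l ^ q * ‖y‖ ^ q) := by linarith
      _ = l * (K * ‖y‖ ^ q * l ^ (q - 1)) := by rw [Real.rpow_sub_one hl.ne']; field_simp
  have hlim : Filter.Tendsto (fun l : ℝ => K * ‖y‖ ^ q * l ^ (q - 1)) (nhdsWithin 0 (Set.Ioi 0))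
      (nhds 0) := by
    have h := (Real.continuousAt_rpow_const 0 (q - 1) (Or.inr (by linarith))).tendsto.const_mul
      (K * ‖y‖ ^ q)
    rw [Real.zero_rpow (by linarith), mul_zero] at h
    exact h.mono_left nhdsWithin_le_nhds
  have hle := ge_of_tendsto hlim (Filter.eventually_of_mem self_mem_nhdsWithin key)
  have hq0 : 0 < q * ‖x‖ ^ (q - 1) := by positivity
  exact norm_le_zero_iff.1 (nonpos_of_mul_nonpos_right hle hq0)

theorem IsPowerSmooth.exists_norm_sub_smul_rpow_le_of_greedy (hX : IsPowerSmooth q K X)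
    (hq : 1 < q) (hK : 0 ≤ K) (hF : ‖F‖ ≤ 1) (hFx : F x = (‖x‖ : 𝕜)) {y : X} (hy : ‖y‖ ≤ 1)
    {A τ : ℝ} (hA : 0 ≤ A) (hτ : 0 ≤ τ) (hxA : ‖x‖ ≤ ‖F y‖ * A) :
    ∃ z : 𝕜, ‖x - z • y‖ ^ q ≤ ‖x‖ ^ q * (1 - q * τ) + K * (A * τ) ^ q := by
  obtain ⟨z, hz⟩ := hX.exists_norm_sub_smul_rpow_le hq hF hFx y (mul_nonneg hA hτ)
  refine ⟨z, hz.trans ?_⟩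
  have hxq : ‖x‖ ^ q = ‖x‖ ^ (q - 1) * ‖x‖ := by
    rw [← Real.rpow_add_one' (norm_nonneg x) (by linarith), sub_add_cancel]
  have hdecrease : ‖x‖ ^ q * (q * τ) ≤ q * ‖x‖ ^ (q - 1) * (A * τ * ‖F y‖) := by
    calc ‖x‖ ^ q * (q * τ) = q * ‖x‖ ^ (q - 1) * τ * ‖x‖ := by rw [hxq]; ring
      _ ≤ q * ‖x‖ ^ (q - 1) * τ * (‖F y‖ * A) := by gcongr
      _ = q * ‖x‖ ^ (q - 1) * (A * τ * ‖F y‖) := by ring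
  have hincrease : K * (A * τ * ‖y‖) ^ q ≤ K * (A * τ) ^ q :=
    mul_le_mul_of_nonneg_left (Real.rpow_le_rpow (by positivity)
      (mul_le_of_le_one_right (by positivity) hy) (by linarith)) hK
  linarith

end NormingFunctional

theorem le_mul_rpow_of_recurrence {q B : ℝ} (hq : 1 ≤ q) (hq2 : q ≤ 2) (hB : 0 ≤ B) {u : ℕ → ℝ}
    {m : ℕ} (h0 : u 0 ≤ B)
    (hu : ∀ i < m, u (i + 1) ≤ u i * (1 - q / (i + 2)) + B * (i + 2 : ℝ) ^ (-q)) :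
    u m ≤ B * (m + 1 : ℝ) ^ (1 - q) := by
  induction m with
  | zero => simpa using h0
  | succ m ih =>
    have hn : (0 : ℝ) < m + 1 := by positivity
    have hpos : (0 : ℝ) < m + 2 := by positivity
    have hfactor : 0 ≤ 1 - q / (m + 2 : ℝ) := by
      rw [sub_nonneg, div_le_one hpos]
      linarith [(Nat.cast_nonneg m : (0 : ℝ) ≤ m)]
    have hBernoulli : (m + 1 : ℝ) ^ (1 - q) ≤
        (m + 2 : ℝ) ^ (1 - q) * (1 + (q - 1) * (1 / (m + 1))) := by
      have h := rpow_one_add_le_one_add_mul_self (s := 1 / (m + 1 : ℝ))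
        (by linarith [one_div_pos.2 hn]) (sub_nonneg.2 hq) (by linarith)
      rw [one_add_div hn.ne', add_right_comm, add_assoc, one_add_one_eq_two,
        Real.div_rpow hpos.le hn.le, div_eq_mul_inv, ← Real.rpow_neg hn.le, neg_sub] at h
      calc (m + 1 : ℝ) ^ (1 - q)
          = (m + 2 : ℝ) ^ (1 - q) * ((m + 2 : ℝ) ^ (q - 1) * (m + 1 : ℝ) ^ (1 - q)) := by
            rw [← mul_assoc, ← Real.rpow_add hpos]
            simp
        _ ≤ _ := by gcongr
    have hstep : (1 + (q - 1) * (1 / (m + 1))) * (1 - q / (m + 2)) ≤ 1 - 1 / (m + 2 : ℝ) := by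
      rw [← sub_nonneg]
      have : 1 - 1 / (m + 2 : ℝ) - (1 + (q - 1) * (1 / (m + 1))) * (1 - q / (m + 2)) =
          (q - 1) ^ 2 / ((m + 1) * (m + 2)) := by field_simp; ring
      rw [this]
      positivity
    have hneg : (m + 2 : ℝ) ^ (-q) = (m + 2 : ℝ) ^ (1 - q) * (1 / (m + 2)) := by
      rw [← sub_sub_cancel_left 1 q, Real.rpow_sub_one hpos.ne', mul_one_div]
    calc u (m + 1) ≤ u m * (1 - q / (m + 2)) + B * (m + 2 : ℝ) ^ (-q) := hu m m.lt_succ_self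
      _ ≤ B * ((m + 2 : ℝ) ^ (1 - q) * (1 + (q - 1) * (1 / (m + 1)))) * (1 - q / (m + 2)) +
          B * (m + 2 : ℝ) ^ (-q) := by
        gcongr
        exact (ih fun i hi => hu i (hi.trans m.lt_succ_self)).trans (by gcongr)
      _ = B * (m + 2 : ℝ) ^ (1 - q) *
          ((1 + (q - 1) * (1 / (m + 1))) * (1 - q / (m + 2)) + 1 / (m + 2)) := by
        rw [hneg]; ring
      _ ≤ B * (m + 2 : ℝ) ^ (1 - q) * 1 := by gcongr; linarith
      _ = B * ((m + 1 : ℕ) + 1 : ℝ) ^ (1 - q) := by push_cast; ring_nf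

section Greedy

variable {ι X : Type*} [NormedAddCommGroup X] [NormedSpace ℂ X]

theorem IsWCGAOutput.support_subset {t : ℝ} {g : ι → X} {Λ : Finset ι} {f : X} {m : ℕ}
    {h : ι →₀ ℂ} (H : IsWCGAOutput t g Λ f m h) : h.support ⊆ Λ ∧ h.support.card ≤ m := by
  classical
  obtain ⟨φ, F, G, hG0, rfl, H⟩ := H
  rcases m with _ | m
  · simp [hG0]
  have hsupp : (G (m + 1)).support ⊆ (Finset.range (m + 1)).image φ := fun k hk => by
    obtain ⟨i, hi, rfl⟩ := (Finsupp.mem_supported ℂ _).1 (H m m.lt_succ_self).2.2.1 hk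
    exact Finset.mem_image_of_mem _ (Finset.mem_range_succ_iff.2 hi)
  constructor
  · intro k hk
    obtain ⟨i, hi, rfl⟩ := Finset.mem_image.1 (hsupp hk)
    exact (H i (Finset.mem_range.1 hi)).2.1.1
  · simpa using (Finset.card_le_card hsupp).trans Finset.card_image_le

theorem exists_best_approximant (g : ι → X) {s : Set ι} (hs : s.Finite) (f : X) :
    ∃ h ∈ Finsupp.supported ℂ ℂ s, ∀ h' ∈ Finsupp.supported ℂ ℂ s,
      ‖f - Finsupp.linearCombination ℂ g h‖ ≤ ‖f - Finsupp.linearCombination ℂ g h'‖ := by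
  set V := Submodule.span ℂ (g '' s)
  have : FiniteDimensional ℂ V := FiniteDimensional.span_of_finite ℂ (hs.image g)
  have : ProperSpace V := FiniteDimensional.proper ℂ V
  have hlim : Filter.Tendsto (fun y : V => ‖f - y‖) (Filter.cocompact V) Filter.atTop := by
    refine Filter.tendsto_atTop_mono (f := fun y : V => ‖y‖ + -‖f‖) (fun y => ?_)
      (Filter.tendsto_atTop_add_const_right _ _ (tendsto_norm_cocompact_atTop (E := V)))
    rw [norm_sub_rev, ← sub_eq_add_neg]
    exact norm_sub_norm_le (y : X) f
  obtain ⟨⟨y, hy⟩, hmin⟩ := Continuous.exists_forall_le (by fun_prop) hlim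
  obtain ⟨h, hh, rfl⟩ := (Finsupp.mem_span_image_iff_linearCombination ℂ).1 hy
  exact ⟨h, hh, fun h' hh' =>
    hmin ⟨_, (Finsupp.mem_span_image_iff_linearCombination ℂ).2 ⟨h', hh', rfl⟩⟩⟩

theorem exists_isWCGAOutput [Nontrivial X] {t : ℝ} (ht : t ≤ 1) (g : ι → X) {Λ : Finset ι}
    (hΛ : Λ.Nonempty) (f : X) (m : ℕ) : ∃ h, IsWCGAOutput t g Λ f m h := by
  induction m with
  | zero =>
    obtain ⟨k, -⟩ := hΛ
    exact ⟨0, fun _ => k, 0, 0, rfl, rfl, fun i hi => absurd hi i.not_lt_zero⟩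
  | succ m ih =>
    obtain ⟨_, φ, F, G, hG0, rfl, H⟩ := ih
    obtain ⟨F', hF', hF'x⟩ := exists_dual_vector' ℂ (f - Finsupp.linearCombination ℂ g (G m))
    obtain ⟨k, hk, hkmax⟩ := Λ.exists_max_image (fun k => ‖F' (g k)‖) hΛ
    set φ' := Function.update φ m k with hφ'
    have himage : ∀ i < m, φ' '' Set.Iic i = φ '' Set.Iic i := fun i hi =>
      Set.image_congr fun j hj => Function.update_of_ne ((Set.mem_Iic.1 hj).trans_lt hi).ne _ _
    obtain ⟨G', hG', hG'min⟩ := exists_best_approximant g ((Set.finite_Iic m).image φ') f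
    refine ⟨G', φ', Function.update F m F', Function.update G (m + 1) G', ?_, ?_, ?_⟩
    · rw [Function.update_of_ne m.succ_ne_zero.symm, hG0]
    · rw [Function.update_self]
    intro i hi
    rw [Function.update_of_ne hi.ne]
    rcases (Nat.lt_succ_iff.1 hi).eq_or_lt with rfl | hi
    · simp only [hφ', Function.update_self]
      exact ⟨⟨hF', hF'x⟩, ⟨hk, fun l hl =>
        (mul_le_of_le_one_left (norm_nonneg _) ht).trans (hkmax l hl)⟩, hG', hG'min⟩
    · have hφi : φ' i = φ i := Function.update_of_ne hi.ne _ _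
      rw [himage i hi, hφi, Function.update_of_ne hi.ne,
        Function.update_of_ne (Nat.succ_lt_succ hi).ne]
      exact H i hi

theorem norm_apply_sum_le_of_greedy {t : ℝ} (ht : 0 < t) {g : ι → X} {s : Finset ι} (c : ι → ℂ)
    {F : StrongDual ℂ X} {M : ℝ} (hmax : ∀ k ∈ s, t * ‖F (g k)‖ ≤ M) :
    ‖F (∑ k ∈ s, c k • g k)‖ ≤ M * ((∑ k ∈ s, ‖c k‖) / t) := by
  rw [← mul_div_assoc, le_div_iff₀' ht, map_sum]
  calc t * ‖∑ k ∈ s, F (c k • g k)‖ ≤ t * ∑ k ∈ s, ‖c k‖ * ‖F (g k)‖ := by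
        gcongr
        exact (norm_sum_le _ _).trans_eq
          (Finset.sum_congr rfl fun k _ => by rw [map_smul, norm_smul])
    _ = ∑ k ∈ s, ‖c k‖ * (t * ‖F (g k)‖) := by
        rw [Finset.mul_sum]
        exact Finset.sum_congr rfl fun k _ => mul_left_comm _ _ _
    _ ≤ ∑ k ∈ s, ‖c k‖ * M := Finset.sum_le_sum fun k hk => by
        gcongr
        exact hmax k hk
    _ = M * ∑ k ∈ s, ‖c k‖ := by rw [← Finset.sum_mul, mul_comm]

variable {q K t : ℝ} {g : ι → X} {Λ s : Finset ι} {m : ℕ} {h : ι →₀ ℂ}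

theorem IsWCGAOutput.exists_residual_norms (hX : IsPowerSmooth q K X) (hq : 1 < q) (hK : 0 ≤ K)
    (ht : 0 < t) (hg : ∀ k ∈ Λ, ‖g k‖ ≤ 1) (hs : s ⊆ Λ) (c : ι → ℂ)
    (H : IsWCGAOutput t g Λ (∑ k ∈ s, c k • g k) m h) :
    ∃ r : ℕ → ℝ, r 0 = ‖∑ k ∈ s, c k • g k‖ ∧
      r m = ‖∑ k ∈ s, c k • g k - Finsupp.linearCombination ℂ g h‖ ∧
      ∀ i < m, ∀ τ : ℝ, 0 ≤ τ →
        r (i + 1) ^ q ≤ r i ^ q * (1 - q * τ) + K * ((∑ k ∈ s, ‖c k‖) / t * τ) ^ q := by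
  obtain ⟨φ, F, G, hG0, rfl, H⟩ := H
  set f := ∑ k ∈ s, c k • g k
  refine ⟨fun i => ‖f - Finsupp.linearCombination ℂ g (G i)‖, by simp [hG0], rfl,
    fun i hi τ hτ => ?_⟩
  obtain ⟨⟨hF, hFx⟩, ⟨hφ, hmax⟩, -, hbest⟩ := H i hi
  set x := f - Finsupp.linearCombination ℂ g (G i) with hx
  have hbest_line : ∀ z : ℂ, ‖f - Finsupp.linearCombination ℂ g (G (i + 1))‖ ≤
      ‖x - z • g (φ i)‖ := fun z => by
    have hGi : G i ∈ Finsupp.supported ℂ ℂ (φ '' Set.Iic i) := by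
      rcases i with _ | i
      · exact hG0 ▸ Submodule.zero_mem _
      · exact Finsupp.supported_mono (Set.image_mono (Set.Iic_subset_Iic.2 i.le_succ))
          (H i (i.lt_succ_self.trans hi)).2.2.1
    have h := hbest _ (Submodule.add_mem _ hGi
      (Finsupp.single_mem_supported ℂ z ⟨i, Set.self_mem_Iic, rfl⟩))
    rwa [map_add, Finsupp.linearCombination_single, ← sub_sub] at h
  have horth : x ≠ 0 → F i (Finsupp.linearCombination ℂ g (G i)) = 0 := fun hx0 => by
    rcases i with _ | i
    · rw [hG0, map_zero, map_zero]
    obtain ⟨-, -, hmem, hmin⟩ := H i (i.lt_succ_self.trans hi)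
    refine hX.norming_apply_eq_zero hq hx0 hF.le hFx fun z => ?_
    have h := hmin _ (Submodule.add_mem _ hmem (Submodule.smul_mem _ z hmem))
    rwa [map_add, map_smul, ← sub_sub] at h
  have hdual : ‖x‖ ≤ ‖F i (g (φ i))‖ * ((∑ k ∈ s, ‖c k‖) / t) := by
    rcases eq_or_ne x 0 with hx0 | hx0
    · rw [hx0, norm_zero]
      positivity
    · have hFf : F i f = (‖x‖ : ℂ) := by rw [← hFx, hx, map_sub, horth hx0, sub_zero]
      have h := norm_apply_sum_le_of_greedy ht c fun k hk => hmax k (hs hk)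
      rwa [show ∑ k ∈ s, c k • g k = f from rfl, hFf, Complex.norm_real, norm_norm] at h
  obtain ⟨z, hz⟩ := hX.exists_norm_sub_smul_rpow_le_of_greedy hq hK hF.le hFx (hg _ hφ)
    (by positivity) hτ hdual
  exact (Real.rpow_le_rpow (norm_nonneg _) (hbest_line z) (by linarith)).trans hz

theorem IsWCGAOutput.norm_sub_le (hX : IsPowerSmooth q K X) (hq : 1 < q) (hq2 : q ≤ 2)
    (hK : 1 ≤ K) (ht : 0 < t) (ht1 : t ≤ 1) (hg : ∀ k ∈ Λ, ‖g k‖ ≤ 1) (hs : s ⊆ Λ) (c : ι → ℂ)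
    (H : IsWCGAOutput t g Λ (∑ k ∈ s, c k • g k) m h) :
    ‖∑ k ∈ s, c k • g k - Finsupp.linearCombination ℂ g h‖ ≤
      K ^ (1 / q) * ((∑ k ∈ s, ‖c k‖) / t) * (m + 1 : ℝ) ^ (1 / q - 1) := by
  obtain ⟨r, hr0, hrm, hr⟩ := H.exists_residual_norms hX hq (by linarith) ht hg hs c
  set A := (∑ k ∈ s, ‖c k‖) / t
  have hA : 0 ≤ A := by positivity
  have hr0A : r 0 ≤ A := by
    rw [hr0]
    refine (norm_sum_le_of_le s fun k hk => ?_).trans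
      (le_div_self (Finset.sum_nonneg fun k _ => norm_nonneg (c k)) ht ht1)
    rw [norm_smul]
    exact mul_le_of_le_one_right (norm_nonneg _) (hg k (hs hk))
  have hrate := le_mul_rpow_of_recurrence (u := fun i => r i ^ q) hq.le hq2
    (show 0 ≤ K * A ^ q by positivity)
    ((Real.rpow_le_rpow (hr0 ▸ norm_nonneg _) hr0A (by linarith)).trans
      (le_mul_of_one_le_left (by positivity) hK))
    (fun i hi => (hr i hi (1 / (i + 2)) (by positivity)).trans_eq (by
      rw [mul_one_div, mul_one_div, Real.div_rpow hA (by positivity),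
        Real.rpow_neg (by positivity)]
      ring))
  rw [← hrm, ← Real.rpow_le_rpow_iff (hrm ▸ norm_nonneg _) (by positivity)
    (show 0 < q by linarith)]
  refine hrate.trans_eq ?_
  rw [Real.mul_rpow (by positivity) (by positivity), Real.mul_rpow (by positivity) hA,
    ← Real.rpow_mul (by linarith), ← Real.rpow_mul (by positivity), one_div_mul_cancel
    (by linarith), Real.rpow_one, sub_mul, one_div_mul_cancel (by linarith), one_mul]

end Greedy

section Selection

variable {ι E : Type*} [SeminormedAddCommGroup E]

/-- The quasi-norm `|·|_{A_β}` of the coefficients `c` over the finite index set `s`. -/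
noncomputable def coeffQuasiNorm (β : ℝ) (s : Finset ι) (c : ι → E) : ℝ :=
  (∑ k ∈ s, ‖c k‖ ^ β) ^ (1 / β)

variable {β : ℝ} {s : Finset ι} {c : ι → E}

theorem coeffQuasiNorm_nonneg : 0 ≤ coeffQuasiNorm β s c := by
  unfold coeffQuasiNorm
  positivity

theorem coeffQuasiNorm_rpow (hβ : β ≠ 0) : coeffQuasiNorm β s c ^ β = ∑ k ∈ s, ‖c k‖ ^ β := by
  rw [coeffQuasiNorm, one_div, Real.rpow_inv_rpow (by positivity) hβ]

theorem sum_norm_le_rpow_mul_sum_rpow (hβ : β ≤ 1) {T : ℝ} (hT : ∀ k ∈ s, ‖c k‖ ≤ T) :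
    ∑ k ∈ s, ‖c k‖ ≤ T ^ (1 - β) * ∑ k ∈ s, ‖c k‖ ^ β := by
  rw [Finset.mul_sum]
  refine Finset.sum_le_sum fun k hk => ?_
  calc ‖c k‖ = ‖c k‖ ^ (1 - β) * ‖c k‖ ^ β := by
        rw [← Real.rpow_add' (norm_nonneg _) (by simp), sub_add_cancel, Real.rpow_one]
    _ ≤ T ^ (1 - β) * ‖c k‖ ^ β := by
        gcongr
        exact hT k hk

end Selection

section LargestSelection

variable {ι : Type*} {β : ℝ} {c : ι → ℂ} {Λ I : Finset ι} {n : ℕ}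

theorem IsLargestSelection.norm_le_of_notMem (H : IsLargestSelection c Λ n I) (hβ : 0 < β) {k : ι}
    (hk : k ∈ Λ) (hkI : k ∉ I) : ‖c k‖ ≤ coeffQuasiNorm β Λ c * (n + 1 : ℝ) ^ (-(1 / β)) := by
  classical
  obtain ⟨hI, hcard, hmax⟩ := H
  have hIΛ : I.card < Λ.card := Finset.card_lt_card (hI.ssubset_of_mem_notMem hk hkI)
  have hIn : I.card = n := by omega
  have hsum : (n + 1 : ℝ) * ‖c k‖ ^ β ≤ coeffQuasiNorm β Λ c ^ β := by
    rw [coeffQuasiNorm_rpow hβ.ne']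
    calc (n + 1 : ℝ) * ‖c k‖ ^ β = ∑ _l ∈ insert k I, ‖c k‖ ^ β := by
          rw [Finset.sum_const, Finset.card_insert_of_notMem hkI, hIn, nsmul_eq_mul]
          push_cast
          rfl
      _ ≤ ∑ l ∈ insert k I, ‖c l‖ ^ β := Finset.sum_le_sum fun l hl => by
          gcongr
          rcases Finset.mem_insert.1 hl with rfl | hl
          exacts [le_rfl, hmax l hl k hk hkI]
      _ ≤ ∑ l ∈ Λ, ‖c l‖ ^ β := Finset.sum_le_sum_of_subset_of_nonneg
          (Finset.insert_subset hk hI) fun _ _ _ => by positivity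
  rw [← Real.rpow_le_rpow_iff (norm_nonneg _)
    (mul_nonneg coeffQuasiNorm_nonneg (by positivity)) hβ,
    Real.mul_rpow coeffQuasiNorm_nonneg (by positivity), ← Real.rpow_mul (by positivity),
    neg_mul, one_div_mul_cancel hβ.ne', Real.rpow_neg_one, ← div_eq_mul_inv,
    le_div_iff₀' (by positivity)]
  exact hsum

/-- Stechkin's inequality. -/
theorem IsLargestSelection.sum_sdiff_le [DecidableEq ι] (H : IsLargestSelection c Λ n I)
    (hβ : 0 < β) (hβ' : β ≤ 1) :
    ∑ k ∈ Λ \ I, ‖c k‖ ≤ coeffQuasiNorm β Λ c * (n + 1 : ℝ) ^ (1 - 1 / β) := by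
  set M := coeffQuasiNorm β Λ c
  have hM : 0 ≤ M := coeffQuasiNorm_nonneg
  calc ∑ k ∈ Λ \ I, ‖c k‖
      ≤ (M * (n + 1 : ℝ) ^ (-(1 / β))) ^ (1 - β) * ∑ k ∈ Λ \ I, ‖c k‖ ^ β :=
        sum_norm_le_rpow_mul_sum_rpow hβ' fun k hk =>
          H.norm_le_of_notMem hβ (Finset.mem_sdiff.1 hk).1 (Finset.mem_sdiff.1 hk).2
    _ ≤ (M * (n + 1 : ℝ) ^ (-(1 / β))) ^ (1 - β) * M ^ β := by
        rw [coeffQuasiNorm_rpow hβ.ne']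
        gcongr
        exact Finset.sdiff_subset
    _ = M ^ (1 - β) * M ^ β * (n + 1 : ℝ) ^ (1 - 1 / β) := by
        rw [Real.mul_rpow hM (by positivity), ← Real.rpow_mul (by positivity),
          show -(1 / β) * (1 - β) = 1 - 1 / β by field_simp; ring]
        ring
    _ = M * (n + 1 : ℝ) ^ (1 - 1 / β) := by
        rw [← Real.rpow_add' hM (by simp), sub_add_cancel, Real.rpow_one]

theorem exists_isLargestSelection (c : ι → ℂ) (Λ : Finset ι) (n : ℕ) :
    ∃ I, IsLargestSelection c Λ n I := by
  classical
  induction n with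
  | zero => exact ⟨∅, by simp [IsLargestSelection]⟩
  | succ n ih =>
    obtain ⟨I, hI, hcard, hmax⟩ := ih
    rcases hI.eq_or_ssubset with rfl | hssub
    · exact ⟨I, hI, by omega, fun k _ l hl hl' => absurd hl hl'⟩
    obtain ⟨k, hk, hkmax⟩ := (Λ \ I).exists_max_image (fun k => ‖c k‖)
      (Finset.sdiff_nonempty.2 hssub.2)
    obtain ⟨hkΛ, hkI⟩ := Finset.mem_sdiff.1 hk
    refine ⟨insert k I, Finset.insert_subset hkΛ hI, ?_, fun i hi l hl hlI => ?_⟩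
    · have := Finset.card_lt_card hssub
      rw [Finset.card_insert_of_notMem hkI]
      omega
    · rw [Finset.mem_insert, not_or] at hlI
      rcases Finset.mem_insert.1 hi with rfl | hi
      · exact hkmax l (Finset.mem_sdiff.2 ⟨hl, hlI.2⟩)
      · exact hmax i hi l hl hlI.2

theorem IsLargestSelection.norm_sub_linearCombination_le [DecidableEq ι] {X : Type*}
    [NormedAddCommGroup X] [NormedSpace ℂ X] {q K : ℝ} (H : IsLargestSelection c Λ n I)
    (hX : IsPowerSmooth q K X) (hq : 1 < q) (hq2 : q ≤ 2) (hK : 1 ≤ K) (hβ : 0 < β) (hβ' : β ≤ 1)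
    {g : ι → X} (hg : ∀ k ∈ Λ, ‖g k‖ ≤ 1) {h : ι →₀ ℂ}
    (hh : IsWCGAOutput 1 g Λ (∑ k ∈ Λ \ I, c k • g k) n h) :
    ‖∑ k ∈ Λ \ I, c k • g k - Finsupp.linearCombination ℂ g h‖ ≤
      K ^ (1 / q) * (n + 1 : ℝ) ^ (1 / q - 1 / β) * coeffQuasiNorm β Λ c := by
  have hgreedy := hh.norm_sub_le hX hq hq2 hK one_pos le_rfl hg Finset.sdiff_subset c
  rw [div_one] at hgreedy
  calc _ ≤ K ^ (1 / q) * (∑ k ∈ Λ \ I, ‖c k‖) * (n + 1 : ℝ) ^ (1 / q - 1) := hgreedy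
    _ ≤ K ^ (1 / q) * (coeffQuasiNorm β Λ c * (n + 1 : ℝ) ^ (1 - 1 / β)) *
        (n + 1 : ℝ) ^ (1 / q - 1) := by
      gcongr
      exact H.sum_sdiff_le hβ hβ'
    _ = K ^ (1 / q) * (n + 1 : ℝ) ^ (1 / q - 1 / β) * coeffQuasiNorm β Λ c := by
      rw [← sub_add_sub_cancel (1 / q) 1 (1 / β), Real.rpow_add (by positivity)]
      ring

end LargestSelection

section Output

theorem linearCombination_indicator {R ι M : Type*} [Semiring R] [AddCommMonoid M] [Module R M]
    (s : Finset ι) (ψ : ι → M) (c : ι → R) :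
    Finsupp.linearCombination R ψ (Finsupp.indicator s fun k _ => c k) = ∑ k ∈ s, c k • ψ k := by
  rw [Finsupp.linearCombination_apply, Finsupp.sum_of_support_subset _
    (Finsupp.support_indicator_subset _ _) _ fun k _ => zero_smul R (ψ k)]
  exact Finset.sum_congr rfl fun k hk => by rw [Finsupp.indicator_of_mem hk]

theorem norm_sub_sum_smul_le {ι X : Type*} [NormedAddCommGroup X] [NormedSpace ℂ X]
    [CompleteSpace X] {c : ι → ℂ} {ψ : ι → X} {f : X} (hf : HasSum (fun k => c k • ψ k) f)
    (hc : Summable fun k => ‖c k‖) (hψ : ∀ k, ‖ψ k‖ ≤ 1) (Q : Finset ι) :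
    ‖f - ∑ k ∈ Q, c k • ψ k‖ ≤ ∑' k : ↥(Q : Set ι)ᶜ, ‖c k‖ := by
  have hle : ∀ k, ‖c k • ψ k‖ ≤ ‖c k‖ := fun k => by
    rw [norm_smul]
    exact mul_le_of_le_one_right (norm_nonneg _) (hψ k)
  have hsub := hc.subtype (Q : Set ι)ᶜ
  rw [← hf.tsum_eq, ← hf.summable.sum_add_tsum_compl (s := Q), add_sub_cancel_left]
  exact tsum_of_norm_bounded hsub.hasSum fun k => hle k

variable {Ω : Type*} [MeasurableSpace Ω] {p : ℝ≥0∞} [Fact (1 ≤ p)]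

theorem isProbabilityMeasure_measureXi (μ : Measure Ω) [IsProbabilityMeasure μ] {m : ℕ}
    (hm : 0 < m) (ξ : Fin m → Ω) : IsProbabilityMeasure (measureXi μ ξ) := by
  have hm' : (m : ℝ≥0∞) ≠ 0 := Nat.cast_ne_zero.2 hm.ne'
  refine ⟨?_⟩
  simp only [measureXi, Measure.smul_apply, Measure.add_apply, Measure.finsetSum_apply,
    smul_eq_mul, measure_univ, Finset.sum_const, Finset.card_univ, Fintype.card_fin, nsmul_eq_mul,
    mul_one]
  rw [ENNReal.inv_mul_cancel hm' (ENNReal.natCast_ne_top m), one_add_one_eq_two,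
    ENNReal.inv_mul_cancel two_ne_zero ENNReal.ofNat_ne_top]

variable {ν : Measure Ω} [IsProbabilityMeasure ν]

theorem nontrivial_Lp : Nontrivial (Lp ℂ p ν) :=
  ⟨Lp.const p ν 1, 0, norm_ne_zero_iff.1 (by
    rw [Lp.norm_const p ν (1 : ℂ) (zero_lt_one.trans_le Fact.out).ne']
    simp)⟩

variable [TopologicalSpace Ω] [CompactSpace Ω] [BorelSpace Ω]

theorem norm_toLp_le (f : C(Ω, ℂ)) : ‖ContinuousMap.toLp p ν ℂ f‖ ≤ ‖f‖ := by
  have h := ContinuousMap.toLp_norm_le (p := p) (E := ℂ) ν (𝕜 := ℂ)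
  rw [show measureUnivNNReal ν = 1 by simp [measureUnivNNReal], NNReal.coe_one,
    Real.one_rpow] at h
  exact (ContinuousLinearMap.le_of_opNorm_le _ h f).trans_eq (one_mul _)

variable {ι : Type*} [DecidableEq ι] {S : GreedyScheme ι} {ψ : ι → C(Ω, ℂ)} {c : ι → ℂ}
  {h : ι →₀ ℂ}

theorem GreedyScheme.exists_isOutput (hS : ∀ j, (S.block j).Nonempty) :
    ∃ h, S.IsOutput p ν ψ c h := by
  have := nontrivial_Lp (p := p) (ν := ν)
  choose I hI using fun j => exists_isLargestSelection c (S.block j) (S.select j)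
  choose G hG using fun j =>
    exists_isWCGAOutput le_rfl (fun k => ContinuousMap.toLp p ν ℂ (ψ k)) (hS j)
      (ContinuousMap.toLp p ν ℂ (∑ k ∈ S.block j \ I j, c k • ψ k)) (S.iterate j)
  exact ⟨_, I, G, fun j => ⟨hI j, hG j⟩, rfl⟩

theorem GreedyScheme.IsOutput.support_subset (H : S.IsOutput p ν ψ c h) :
    h.support ⊆ Finset.univ.biUnion S.block ∧
      h.support.card ≤ ∑ j, (S.select j + S.iterate j) := by
  obtain ⟨I, G, H, rfl⟩ := H
  have hsub : (∑ j, (Finsupp.indicator (I j) (fun k _ => c k) + G j)).support ⊆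
      Finset.univ.biUnion fun j => I j ∪ (G j).support :=
    Finsupp.support_finsetSum.trans (Finset.biUnion_mono fun j _ => Finsupp.support_add.trans
      (Finset.union_subset_union (Finsupp.support_indicator_subset _ _) le_rfl))
  constructor
  · exact hsub.trans (Finset.biUnion_mono fun j _ =>
      Finset.union_subset (H j).1.1 (H j).2.support_subset.1)
  · refine (Finset.card_le_card hsub).trans (Finset.card_biUnion_le.trans
      (Finset.sum_le_sum fun j _ => (Finset.card_union_le _ _).trans ?_))
    exact add_le_add ((H j).1.2.1.trans_le (min_le_left _ _)) (H j).2.support_subset.2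

/-- In each block the terms kept by the scheme cancel, so only the errors of the greedy algorithm
and the terms outside all blocks remain. -/
theorem GreedyScheme.IsOutput.norm_sub_le (H : S.IsOutput p ν ψ c h) {f : C(Ω, ℂ)}
    (hf : HasSum (fun k => c k • ψ k) f) (hc : Summable fun k => ‖c k‖) (hψ : ∀ k, ‖ψ k‖ ≤ 1)
    {e : Fin S.num → ℝ}
    (he : ∀ j I G, IsLargestSelection c (S.block j) (S.select j) I →
      IsWCGAOutput 1 (fun k => ContinuousMap.toLp p ν ℂ (ψ k)) (S.block j)
        (∑ k ∈ S.block j \ I, c k • ContinuousMap.toLp p ν ℂ (ψ k)) (S.iterate j) G →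
      ‖∑ k ∈ S.block j \ I, c k • ContinuousMap.toLp p ν ℂ (ψ k) -
        Finsupp.linearCombination ℂ (fun k => ContinuousMap.toLp p ν ℂ (ψ k)) G‖ ≤ e j) :
    ‖ContinuousMap.toLp p ν ℂ (f - Finsupp.linearCombination ℂ ψ h)‖ ≤
      ∑ j, e j + ∑' k : ↥(↑(Finset.univ.biUnion S.block) : Set ι)ᶜ, ‖c k‖ := by
  obtain ⟨I, G, H, rfl⟩ := H
  set T := ContinuousMap.toLp (E := ℂ) p ν ℂ
  set Q := Finset.univ.biUnion S.block
  have hsplit : f - Finsupp.linearCombination ℂ ψ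
        (∑ j, (Finsupp.indicator (I j) (fun k _ => c k) + G j)) =
      ∑ j, (∑ k ∈ S.block j \ I j, c k • ψ k - Finsupp.linearCombination ℂ ψ (G j)) +
        (f - ∑ k ∈ Q, c k • ψ k) := by
    rw [Finset.sum_biUnion fun i _ j _ hij => S.disjoint hij, map_sum]
    simp only [map_add, linearCombination_indicator, Finset.sum_sub_distrib, Finset.sum_add_distrib,
      fun j => (Finset.sum_sdiff (f := fun k => c k • ψ k) (H j).1.1).symm]
    abel
  have hsum : ∀ s : Finset ι, T (∑ k ∈ s, c k • ψ k) = ∑ k ∈ s, c k • T (ψ k) := fun s => by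
    simp only [map_sum, map_smul]
  rw [hsplit, map_add, map_sum]
  refine (norm_add_le _ _).trans (add_le_add (norm_sum_le_of_le _ fun j _ => ?_)
    ((norm_toLp_le _).trans (norm_sub_sum_smul_le hf hc hψ Q)))
  have hlc : T (Finsupp.linearCombination ℂ ψ (G j)) =
      Finsupp.linearCombination ℂ (fun k => T (ψ k)) (G j) :=
    Finsupp.apply_linearCombination ℂ (T : C(Ω, ℂ) →ₗ[ℂ] Lp ℂ p ν) ψ (G j)
  rw [map_sub, hsum, hlc]
  exact he j (I j) (G j) (H j).1 (hsum _ ▸ (H j).2)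

end Output

section Layers

/-- The index of the hyperbolic layer containing `k`, that is, `‖s‖₁` for the `s` with `k ∈ ρ(s)`;
`s i` is the binary length of `|k i|`. -/
def hyperbolicLevel {d : ℕ} (k : Fin d → ℤ) : ℕ :=
  ∑ i, (k i).natAbs.size

/-- The step hyperbolic cross: the union of the hyperbolic layers with index less than `J`. -/
noncomputable def hyperbolicCross (d J : ℕ) : Finset (Fin d → ℤ) :=
  (Finset.range J).biUnion (hyperbolicLayer d)

theorem size_natAbs_eq_iff {x : ℤ} {t : ℕ} :
    x.natAbs.size = t ↔ |x| < 2 ^ t ∧ 2 ^ t / 2 ≤ |x| := by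
  rw [Int.abs_eq_natAbs]
  generalize x.natAbs = y
  rcases t with _ | t
  · rw [Nat.size_eq_zero]
    norm_num
  · rw [pow_succ, Int.mul_ediv_cancel _ two_ne_zero, ← pow_succ]
    have hlt := @Nat.size_le y (t + 1)
    have hge := @Nat.lt_size t y
    zify at hlt hge
    rw [← hlt, ← hge]
    omega

variable {d : ℕ}

theorem mem_dyadicBlock_iff {s : Fin d → ℕ} {k : Fin d → ℤ} :
    k ∈ dyadicBlock s ↔ ∀ i, (k i).natAbs.size = s i := by
  simp only [dyadicBlock, Fintype.mem_piFinset, Finset.mem_filter, Finset.mem_Ioo, ← abs_lt,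
    size_natAbs_eq_iff]

theorem mem_hyperbolicLayer_iff {j : ℕ} {k : Fin d → ℤ} :
    k ∈ hyperbolicLayer d j ↔ hyperbolicLevel k = j := by
  simp only [hyperbolicLayer, Finset.mem_biUnion, Finset.mem_piAntidiag, mem_dyadicBlock_iff]
  constructor
  · rintro ⟨s, ⟨hs, -⟩, h⟩
    exact (Finset.sum_congr rfl fun i _ => h i).trans hs
  · exact fun h => ⟨fun i => (k i).natAbs.size, ⟨h, fun _ _ => Finset.mem_univ _⟩, fun _ => rfl⟩

theorem mem_hyperbolicCross_iff {J : ℕ} {k : Fin d → ℤ} :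
    k ∈ hyperbolicCross d J ↔ hyperbolicLevel k < J := by
  simp [hyperbolicCross, mem_hyperbolicLayer_iff]

theorem disjoint_hyperbolicLayer {i j : ℕ} (h : i ≠ j) :
    Disjoint (hyperbolicLayer d i) (hyperbolicLayer d j) :=
  Finset.disjoint_left.2 fun _ hi hj =>
    h ((mem_hyperbolicLayer_iff.1 hi).symm.trans (mem_hyperbolicLayer_iff.1 hj))

theorem hyperbolicLayer_nonempty (hd : 1 ≤ d) (j : ℕ) : (hyperbolicLayer d j).Nonempty := by
  refine ⟨Pi.single ⟨0, hd⟩ ((2 ^ j / 2 : ℕ) : ℤ), mem_hyperbolicLayer_iff.2 ?_⟩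
  rw [hyperbolicLevel, Finset.sum_eq_single ⟨0, hd⟩ (fun i _ hi => by simp [hi]) (by simp),
    Pi.single_eq_same, Int.natAbs_natCast]
  rcases j with _ | j
  · simp
  · rw [pow_succ, Nat.mul_div_cancel _ two_pos, Nat.size_pow]

theorem card_dyadicBlock (s : Fin d → ℕ) : (dyadicBlock s).card = 2 ^ ∑ i, s i := by
  rw [dyadicBlock, Fintype.card_piFinset, ← Finset.prod_pow_eq_pow_sum]
  refine Finset.prod_congr rfl fun i _ => ?_
  have hdiff : (Finset.Ioo (-(2 : ℤ) ^ s i) (2 ^ s i)).filter (fun k => (2 : ℤ) ^ s i / 2 ≤ |k|) =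
      Finset.Ioo (-(2 : ℤ) ^ s i) (2 ^ s i) \ Finset.Ioo (-(2 ^ s i / 2)) (2 ^ s i / 2) := by
    ext k
    simp only [Finset.mem_filter, Finset.mem_sdiff, Finset.mem_Ioo, ← abs_lt, not_lt]
  have hpos : 0 < (2 : ℤ) ^ s i := by positivity
  rw [hdiff, Finset.card_sdiff_of_subset (Finset.Ioo_subset_Ioo (by omega) (by omega)),
    Int.card_Ioo, Int.card_Ioo]
  rcases s i with _ | t
  · simp
  · have : 0 < (2 : ℤ) ^ t := by positivity
    zify
    rw [pow_succ, Int.mul_ediv_cancel _ two_ne_zero]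
    omega

theorem card_piAntidiag_univ_le (e j : ℕ) :
    (Finset.piAntidiag (Finset.univ : Finset (Fin (e + 1))) j).card ≤ (j + 1) ^ e := by
  have hcard : (Fintype.piFinset fun _ : Fin e => Finset.range (j + 1)).card = (j + 1) ^ e := by
    rw [Fintype.card_piFinset_const, Finset.card_range]
  rw [← hcard]
  refine Finset.card_le_card_of_injOn Fin.tail (fun s hs => ?_) fun s hs s' hs' htail => ?_
  · refine Fintype.mem_piFinset.2 fun i => Finset.mem_range.2 (Nat.lt_succ_of_le ?_)
    rw [← (Finset.mem_piAntidiag.1 hs).1]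
    exact Finset.single_le_sum (f := s) (fun _ _ => Nat.zero_le _) (Finset.mem_univ i.succ)
  · have hsum := (Finset.mem_piAntidiag.1 hs).1.trans (Finset.mem_piAntidiag.1 hs').1.symm
    have htail' : ∀ i : Fin e, s i.succ = s' i.succ := congrFun htail
    simp only [Fin.sum_univ_succ, htail', Nat.add_right_cancel_iff] at hsum
    exact funext (Fin.cases hsum htail')

theorem card_hyperbolicLayer_le (e j : ℕ) :
    (hyperbolicLayer (e + 1) j).card ≤ 2 ^ j * (j + 1) ^ e := by
  refine (Finset.card_biUnion_le_card_mul _ _ (2 ^ j) fun s hs => ?_).trans ?_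
  · rw [card_dyadicBlock, (Finset.mem_piAntidiag.1 hs).1]
  · rw [mul_comm]
    exact Nat.mul_le_mul_left _ (card_piAntidiag_univ_le e j)

theorem sum_card_hyperbolicLayer_le (e N : ℕ) :
    ∑ j ∈ Finset.range N, (hyperbolicLayer (e + 1) j).card ≤ (2 ^ N - 1) * N ^ e := by
  calc ∑ j ∈ Finset.range N, (hyperbolicLayer (e + 1) j).card
      ≤ ∑ j ∈ Finset.range N, 2 ^ j * N ^ e := Finset.sum_le_sum fun j hj =>
        (card_hyperbolicLayer_le e j).trans
          (Nat.mul_le_mul_left _ (Nat.pow_le_pow_left (Finset.mem_range.1 hj) e))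
    _ = (2 ^ N - 1) * N ^ e := by
      rw [← Finset.sum_mul, Nat.geomSum_eq le_rfl, Nat.div_one]

theorem card_hyperbolicCross_le (d J : ℕ) : (hyperbolicCross d J).card ≤ 2 ^ (J * d) := by
  rcases J with _ | J
  · simp [hyperbolicCross]
  have hsub : hyperbolicCross d (J + 1) ⊆
      Fintype.piFinset fun _ => Finset.Ico (-((2 ^ J : ℕ) : ℤ)) (2 ^ J : ℕ) := fun k hk => by
    refine Fintype.mem_piFinset.2 fun i => ?_
    have hsize : (k i).natAbs.size ≤ J :=
      (Finset.single_le_sum (f := fun i => (k i).natAbs.size) (fun _ _ => Nat.zero_le _)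
        (Finset.mem_univ i)).trans (Nat.le_of_lt_succ (mem_hyperbolicCross_iff.1 hk))
    have habs := Nat.size_le.1 hsize
    rw [Finset.mem_Ico]
    omega
  refine (Finset.card_le_card hsub).trans_eq ?_
  rw [Fintype.card_piFinset_const, Int.card_Ico, sub_neg_eq_add, ← Nat.cast_add,
    Int.toNat_natCast, ← two_mul, ← pow_succ', ← pow_mul]

theorem tsum_compl_hyperbolicCross_le {J : ℕ} {c : (Fin d → ℤ) → ℝ} (hc : ∀ k, 0 ≤ c k)
    {M : ℕ → ℝ} (hM : ∀ l, ∑ k ∈ hyperbolicLayer d (J + l), c k ≤ M l) (hsum : Summable M) :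
    ∑' k : ↥(hyperbolicCross d J : Set (Fin d → ℤ))ᶜ, c k ≤ ∑' l, M l := by
  have hM0 : ∀ l, 0 ≤ M l := fun l => (Finset.sum_nonneg fun k _ => hc k).trans (hM l)
  refine Real.tsum_le_of_sum_le (fun k => hc k) fun T => ?_
  set L := T.sup fun k => hyperbolicLevel k.1
  have hsub : T.map (Function.Embedding.subtype _) ⊆
      (Finset.range (L + 1)).biUnion fun l => hyperbolicLayer d (J + l) := fun k hk => by
    obtain ⟨k, hkT, rfl⟩ := Finset.mem_map.1 hk
    have hJ : J ≤ hyperbolicLevel k.1 := not_lt.1 fun h => k.2 (mem_hyperbolicCross_iff.2 h)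
    have hL : hyperbolicLevel k.1 ≤ L := Finset.le_sup (f := fun k => hyperbolicLevel k.1) hkT
    exact Finset.mem_biUnion.2 ⟨hyperbolicLevel k.1 - J, Finset.mem_range.2 (by omega),
      mem_hyperbolicLayer_iff.2 (Nat.add_sub_cancel' hJ).symm⟩
  calc ∑ k ∈ T, c k = ∑ k ∈ T.map (Function.Embedding.subtype _), c k := by
        rw [Finset.sum_map]; rfl
    _ ≤ ∑ k ∈ (Finset.range (L + 1)).biUnion fun l => hyperbolicLayer d (J + l), c k :=
      Finset.sum_le_sum_of_subset_of_nonneg hsub fun k _ _ => hc k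
    _ = ∑ l ∈ Finset.range (L + 1), ∑ k ∈ hyperbolicLayer d (J + l), c k :=
      Finset.sum_biUnion fun i _ j _ hij => disjoint_hyperbolicLayer (by simpa using hij)
    _ ≤ ∑ l ∈ Finset.range (L + 1), M l := Finset.sum_le_sum fun l _ => hM l
    _ ≤ ∑' l, M l := hsum.sum_le_tsum _ fun l _ => hM0 l

end Layers

section Scheme

/-- The greedy-based method whose blocks are the hyperbolic layers with index less than `N + L`.
The layers below `N` are kept completely; in the layer `N + l` the method selects `n l`
coefficients and performs `n l` iterations. -/
noncomputable def hyperbolicScheme (d N L : ℕ) (n : ℕ → ℕ) : GreedyScheme (Fin d → ℤ) where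
  num := N + L
  block j := hyperbolicLayer d j
  disjoint _ _ h := disjoint_hyperbolicLayer (Fin.val_ne_of_ne h)
  select j := if (j : ℕ) < N then (hyperbolicLayer d j).card else n (j - N)
  iterate j := if (j : ℕ) < N then 0 else n (j - N)

variable {d N L : ℕ} {n : ℕ → ℕ}

theorem biUnion_block_hyperbolicScheme :
    Finset.univ.biUnion (hyperbolicScheme d N L n).block = hyperbolicCross d (N + L) := by
  ext k
  simp only [hyperbolicScheme, hyperbolicCross, Finset.mem_biUnion, Finset.mem_range]
  exact ⟨fun ⟨j, _, hk⟩ => ⟨j, j.2, hk⟩, fun ⟨j, hj, hk⟩ => ⟨⟨j, hj⟩, Finset.mem_univ _, hk⟩⟩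

theorem sum_num_hyperbolicScheme {M : Type*} [AddCommMonoid M] (F : ℕ → M) :
    ∑ j : Fin (hyperbolicScheme d N L n).num, F j =
      ∑ j ∈ Finset.range N, F j + ∑ l ∈ Finset.range L, F (N + l) :=
  (Fin.sum_univ_eq_sum_range F (N + L)).trans (Finset.sum_range_add F N L)

theorem sum_select_add_iterate_hyperbolicScheme :
    ∑ j, ((hyperbolicScheme d N L n).select j + (hyperbolicScheme d N L n).iterate j) =
      ∑ j ∈ Finset.range N, (hyperbolicLayer d j).card + 2 * ∑ l ∈ Finset.range L, n l := by
  refine (sum_num_hyperbolicScheme fun j => (if j < N then (hyperbolicLayer d j).card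
    else n (j - N)) + (if j < N then 0 else n (j - N))).trans ?_
  rw [Finset.mul_sum]
  congr 1
  · refine Finset.sum_congr rfl fun j hj => ?_
    rw [if_pos (Finset.mem_range.1 hj), if_pos (Finset.mem_range.1 hj), add_zero]
  · refine Finset.sum_congr rfl fun l _ => ?_
    rw [if_neg (by omega), if_neg (by omega), Nat.add_sub_cancel_left, two_mul]

variable {Ω : Type*} [TopologicalSpace Ω] [CompactSpace Ω] [MeasurableSpace Ω] [BorelSpace Ω]
  {p : ℝ≥0∞} [Fact (1 ≤ p)] {ν : Measure Ω} [IsProbabilityMeasure ν]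
  {ψ : (Fin d → ℤ) → C(Ω, ℂ)} {c : (Fin d → ℤ) → ℂ} {h : (Fin d → ℤ) →₀ ℂ}

theorem norm_toLp_sub_le_of_isOutput_hyperbolicScheme {q K β : ℝ}
    (hX : IsPowerSmooth q K (Lp ℂ p ν)) (hq : 1 < q) (hq2 : q ≤ 2) (hK : 1 ≤ K) (hβ : 0 < β)
    (hβ' : β ≤ 1) {f : C(Ω, ℂ)} (hf : HasSum (fun k => c k • ψ k) f) (hc : Summable fun k => ‖c k‖)
    (hψ : ∀ k, ‖ψ k‖ ≤ 1) (hn : ∀ l, L ≤ l → n l = 0) {E : ℕ → ℝ} (hE : Summable E)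
    (hle : ∀ l, K ^ (1 / q) * (n l + 1 : ℝ) ^ (1 / q - 1 / β) *
      coeffQuasiNorm β (hyperbolicLayer d (N + l)) c ≤ E l)
    (H : (hyperbolicScheme d N L n).IsOutput p ν ψ c h) :
    ‖ContinuousMap.toLp p ν ℂ (f - Finsupp.linearCombination ℂ ψ h)‖ ≤ ∑' l, E l := by
  have htail : ∑' k : ↥(hyperbolicCross d (N + L) : Set (Fin d → ℤ))ᶜ, ‖c k‖ ≤
      ∑' l, E (L + l) := by
    refine tsum_compl_hyperbolicCross_le (fun k => norm_nonneg (c k)) (fun l => ?_)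
      (hE.comp_injective (add_right_injective L))
    have hlayer := hle (L + l)
    rw [hn _ (Nat.le_add_right L l), Nat.cast_zero, zero_add, Real.one_rpow, mul_one,
      ← add_assoc] at hlayer
    refine le_trans ?_ ((le_mul_of_one_le_left coeffQuasiNorm_nonneg
      (Real.one_le_rpow hK (by positivity))).trans hlayer)
    simpa using IsLargestSelection.sum_sdiff_le (n := 0) (I := ∅) (c := c)
      (Λ := hyperbolicLayer d (N + L + l)) (by simp [IsLargestSelection]) hβ hβ'
  have hblocks := H.norm_sub_le hf hc hψ (e := fun j => if (j : ℕ) < N then 0 else E (j - N)) ?_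
  · rw [sum_num_hyperbolicScheme fun j => if j < N then 0 else E (j - N),
      Finset.sum_eq_zero fun j hj => if_pos (Finset.mem_range.1 hj), zero_add,
      biUnion_block_hyperbolicScheme] at hblocks
    simp only [add_lt_iff_neg_left, not_lt_zero, if_false, Nat.add_sub_cancel_left] at hblocks
    rw [← hE.sum_add_tsum_nat_add L]
    simp only [add_comm _ L]
    exact hblocks.trans (add_le_add_right htail _)
  · intro j I G hI hG
    simp only [hyperbolicScheme] at hI hG ⊢
    split_ifs at hI hG ⊢ with hj
    · have hIeq := Finset.eq_of_subset_of_card_le hI.1 (hI.2.1.trans (min_self _)).ge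
      obtain ⟨-, -, G', hG'0, hG', -⟩ := hG
      simp [hIeq, ← hG', hG'0]
    · have hlej := hle (j - N)
      rw [Nat.add_sub_cancel' (not_lt.1 hj)] at hlej
      exact (hI.norm_sub_linearCombination_le hX hq hq2 hK hβ hβ'
        (fun k _ => (norm_toLp_le _).trans (hψ k)) hG).trans hlej

end Scheme

section Parameters

theorem exists_level (e : ℕ) {v : ℕ} (hv : 1 ≤ v) :
    ∃ N : ℕ, 2 * ((2 ^ N - 1) * N ^ e) ≤ v ∧ 2 ^ N ≤ v ∧ v ≤ 4 * (2 ^ N * (N + 1) ^ e) := by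
  have hpow : ∀ N, 2 * ((2 ^ N - 1) * N ^ e) ≤ v → 2 ^ N ≤ v := fun N hN => by
    rcases N with _ | N
    · simpa using hv
    have hle := Nat.le_mul_of_pos_right (2 ^ (N + 1) - 1) (Nat.pow_pos (n := e) (Nat.add_one_pos N))
    have hgt := Nat.one_lt_two_pow N.succ_ne_zero
    omega
  by_contra! hno
  have hall : ∀ N, 2 * ((2 ^ N - 1) * N ^ e) ≤ v := fun N => by
    induction N with
    | zero => simp
    | succ N ih =>
      calc 2 * ((2 ^ (N + 1) - 1) * (N + 1) ^ e) ≤ 2 * (2 ^ (N + 1) * (N + 1) ^ e) := by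
            gcongr
            exact Nat.sub_le _ _
        _ = 4 * (2 ^ N * (N + 1) ^ e) := by ring
        _ ≤ v := (hno N ih (hpow N ih)).le
  exact (hpow v (hall v)).not_gt v.lt_two_pow_self

theorem rpow_le_mul_rpow_abs {x y t : ℝ} (hx : 0 < x) (hy : 0 < y) (hxy : x ≤ y * t)
    (hyx : y ≤ x * t) (s : ℝ) : x ^ s ≤ y ^ s * t ^ |s| := by
  have ht : 0 < t := pos_of_mul_pos_right (hx.trans_le hxy) hy.le
  rcases le_total 0 s with hs | hs
  · rw [abs_of_nonneg hs, ← Real.mul_rpow hy.le ht.le]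
    exact Real.rpow_le_rpow hx.le hxy hs
  · rw [abs_of_nonpos hs, Real.rpow_neg ht.le, ← div_eq_mul_inv, ← Real.div_rpow hy.le ht.le]
    exact Real.rpow_le_rpow_of_nonpos (by positivity) ((div_le_iff₀ ht).2 hyx) hs

section Level

variable {e N v : ℕ}

theorem level_succ_le_log (hN : 2 ^ N ≤ v) :
    (N + 1 : ℝ) ≤ Real.log (2 * v) * (e + 3) := by
  have hN' : (2 : ℝ) ^ (N + 1) ≤ 2 * v := by
    rw [pow_succ']
    exact_mod_cast Nat.mul_le_mul_left 2 hN
  have hlog := Real.log_le_log (by positivity) hN'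
  rw [Real.log_pow] at hlog
  push_cast at hlog
  have hlog2 : (1 / 3 : ℝ) ≤ Real.log 2 := by linarith [Real.log_two_gt_d9]
  calc (N + 1 : ℝ) = (N + 1) * (1 / 3) * 3 := by ring
    _ ≤ (N + 1) * Real.log 2 * (e + 3) := by
        gcongr
        linarith [e.cast_nonneg (α := ℝ)]
    _ ≤ Real.log (2 * v) * (e + 3) := by gcongr

theorem log_le_level_succ (hv : 1 ≤ v) (hvN : v ≤ 4 * (2 ^ N * (N + 1) ^ e)) :
    Real.log (2 * v) ≤ (N + 1 : ℝ) * (e + 3) := by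
  have hv0 : (0 : ℝ) < v := Nat.cast_pos.2 hv
  have hvN' : (2 * v : ℝ) ≤ 2 ^ (N + 3) * (N + 1 : ℝ) ^ e := by
    have hcast : (v : ℝ) ≤ 4 * (2 ^ N * (N + 1) ^ e) := by exact_mod_cast hvN
    rw [pow_add]
    linarith
  have hlogN : Real.log (N + 1) ≤ N := by
    simpa using Real.log_le_sub_one_of_pos (Nat.cast_add_one_pos (α := ℝ) N)
  calc Real.log (2 * v) ≤ Real.log (2 ^ (N + 3) * (N + 1 : ℝ) ^ e) :=
        Real.log_le_log (mul_pos two_pos hv0) hvN'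
    _ = (N + 3) * Real.log 2 + e * Real.log (N + 1) := by
        rw [Real.log_mul (by positivity) (by positivity), Real.log_pow, Real.log_pow]
        push_cast
        rfl
    _ ≤ (N + 3) * 1 + e * N := by
        gcongr
        linarith [Real.log_two_lt_d9]
    _ ≤ (N + 1 : ℝ) * (e + 3) := by
        linarith [N.cast_nonneg (α := ℝ), e.cast_nonneg (α := ℝ)]

theorem two_rpow_mul_level_rpow_le (hv : 1 ≤ v) (hN : 2 ^ N ≤ v)
    (hvN : v ≤ 4 * (2 ^ N * (N + 1) ^ e)) {a : ℝ} (ha : 0 ≤ a) (b : ℝ) :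
    (2 : ℝ) ^ (-a * N) * (N + 1 : ℝ) ^ (e * b) ≤
      4 ^ a * (e + 3 : ℝ) ^ |e * (a + b)| *
        ((v : ℝ) ^ (-a) * Real.log (2 * v) ^ (e * (a + b))) := by
  have hv1 : (1 : ℝ) ≤ v := Nat.one_le_cast.2 hv
  have hlog : 0 < Real.log (2 * v) := Real.log_pos (by linarith)
  have hpow : (2 : ℝ) ^ (-a * N) ≤ 4 ^ a * (v : ℝ) ^ (-a) * (N + 1 : ℝ) ^ (e * a) := by
    have hcast : (v : ℝ) ≤ 4 * (2 ^ (N : ℝ) * (N + 1 : ℝ) ^ (e : ℝ)) := by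
      rw [Real.rpow_natCast, Real.rpow_natCast]
      exact_mod_cast hvN
    have hva := Real.rpow_le_rpow (by positivity) hcast ha
    rw [Real.mul_rpow (by positivity) (by positivity),
      Real.mul_rpow (by positivity) (by positivity), ← Real.rpow_mul (by positivity),
      ← Real.rpow_mul (by positivity)] at hva
    rw [neg_mul, mul_comm a, Real.rpow_neg (by positivity), Real.rpow_neg (by positivity) a,
      ← div_eq_mul_inv, div_mul_eq_mul_div, inv_eq_one_div, div_le_div_iff₀ (by positivity)
      (by positivity)]
    linarith
  calc (2 : ℝ) ^ (-a * N) * (N + 1 : ℝ) ^ (e * b)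
      ≤ 4 ^ a * (v : ℝ) ^ (-a) * (N + 1 : ℝ) ^ (e * a) * (N + 1 : ℝ) ^ (e * b) := by gcongr
    _ = 4 ^ a * (v : ℝ) ^ (-a) * (N + 1 : ℝ) ^ (e * (a + b)) := by
        rw [mul_assoc, ← Real.rpow_add (by positivity), mul_add]
    _ ≤ 4 ^ a * (v : ℝ) ^ (-a) *
          (Real.log (2 * v) ^ (e * (a + b)) * (e + 3 : ℝ) ^ |e * (a + b)|) := by
        gcongr
        exact rpow_le_mul_rpow_abs (by positivity) hlog (level_succ_le_log hN)
          (log_le_level_succ hv hvN) _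
    _ = _ := by ring

end Level

section Ratio

variable {r u : ℝ}

theorem exists_ratio {a θ : ℝ} (ha : 0 < a) (hθ : 0 < θ) :
    ∃ r : ℝ, 0 < r ∧ r < 1 ∧ r ^ (-θ) * 2 ^ (-a) < 1 := by
  refine ⟨2 ^ (-(a / (2 * θ))), by positivity,
    Real.rpow_lt_one_of_one_lt_of_neg one_lt_two (by simpa using by positivity), ?_⟩
  rw [← Real.rpow_mul zero_le_two, ← Real.rpow_add zero_lt_two]
  refine Real.rpow_lt_one_of_one_lt_of_neg one_lt_two ?_
  have : -(a / (2 * θ)) * -θ = a / 2 := by field_simp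
  linarith

theorem sum_floor_geometric_le (hr : 0 < r) (hr1 : r < 1) (hu : 0 ≤ u) (L : ℕ) :
    ((∑ l ∈ Finset.range L, ⌊u * r ^ l⌋₊ : ℕ) : ℝ) ≤ u / (1 - r) := by
  rw [Nat.cast_sum]
  calc ∑ l ∈ Finset.range L, (⌊u * r ^ l⌋₊ : ℝ)
      ≤ ∑ l ∈ Finset.range L, u * r ^ l :=
        Finset.sum_le_sum fun l _ => Nat.floor_le (by positivity)
    _ ≤ u * (1 - r)⁻¹ := by
        rw [← Finset.mul_sum, ← tsum_geometric_of_lt_one hr.le hr1]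
        gcongr
        exact (summable_geometric_of_lt_one hr.le hr1).sum_le_tsum _ fun l _ => by positivity
    _ = u / (1 - r) := (div_eq_mul_inv _ _).symm

theorem floor_mul_pow_eq_zero (hr : 0 < r) (hr1 : r < 1) {m v l : ℕ} (hm : r ^ m ≤ 1 / 2)
    (hl : m * Nat.clog 2 v ≤ l) (hu : u < v) : ⌊u * r ^ l⌋₊ = 0 := by
  refine Nat.floor_eq_zero.2 ?_
  have hv : (v : ℝ) ≤ 2 ^ Nat.clog 2 v := by exact_mod_cast Nat.le_pow_clog one_lt_two v
  calc u * r ^ l < v * r ^ l := by gcongr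
    _ ≤ v * r ^ (m * Nat.clog 2 v) :=
        mul_le_mul_of_nonneg_left (pow_le_pow_of_le_one hr.le hr1.le hl) v.cast_nonneg
    _ ≤ 2 ^ Nat.clog 2 v * (1 / 2) ^ Nat.clog 2 v := by
        rw [pow_mul]
        gcongr
    _ = 1 := by rw [← mul_pow]; norm_num

theorem summable_pow_mul_rpow (hr : 0 < r) (hr1 : r < 1) (s : ℝ) :
    Summable fun l : ℕ => r ^ l * (l + 2 : ℝ) ^ s := by
  have hgeom : Summable fun l : ℕ => (l : ℝ) ^ ⌈s⌉₊ * r ^ l :=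
    summable_pow_mul_geometric_of_norm_lt_one _ (by rwa [Real.norm_of_nonneg hr.le])
  have hshift := (summable_nat_add_iff 2).2 hgeom
  refine Summable.of_nonneg_of_le (fun l => by positivity) (fun l => ?_)
    (hshift.mul_left (r ^ 2)⁻¹)
  have hle : (l + 2 : ℝ) ^ s ≤ (l + 2 : ℝ) ^ ⌈s⌉₊ := by
    rw [← Real.rpow_natCast]
    have hbase : (1 : ℝ) ≤ l + 2 := by linarith [l.cast_nonneg (α := ℝ)]
    exact Real.rpow_le_rpow_of_exponent_le hbase (Nat.le_ceil s)
  calc r ^ l * (l + 2 : ℝ) ^ s ≤ r ^ l * (l + 2 : ℝ) ^ ⌈s⌉₊ := by gcongr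
    _ = (r ^ 2)⁻¹ * (((l + 2 : ℕ) : ℝ) ^ ⌈s⌉₊ * r ^ (l + 2)) := by
        rw [pow_add]
        push_cast
        field_simp

theorem max_add_one_rpow_le (N l : ℕ) (s : ℝ) :
    max ((N + l : ℕ) : ℝ) 1 ^ s ≤ (N + 1 : ℝ) ^ s * (l + 2 : ℝ) ^ |s| := by
  have hmul : (0 : ℝ) ≤ N * l := by positivity
  have h1 : (1 : ℝ) ≤ max ((N + l : ℕ) : ℝ) 1 := le_max_right _ _
  have hNl : (N + l : ℝ) ≤ max ((N + l : ℕ) : ℝ) 1 := by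
    rw [← Nat.cast_add]
    exact le_max_left _ _
  refine rpow_le_mul_rpow_abs (by positivity) (by positivity) (max_le ?_ ?_) ?_ s
  · push_cast
    linarith [N.cast_nonneg (α := ℝ)]
  · linarith [N.cast_nonneg (α := ℝ)]
  · nlinarith [mul_nonneg (zero_le_one.trans h1) (Nat.cast_add_one_pos (α := ℝ) l).le]

/-- The factor `(⌊w⌋ + 1) ^ (-θ)` comes from `⌊w⌋` greedy steps, the rest from the class; with
`w = u r ^ l` their product decays like `(r ^ (-θ) 2 ^ (-a)) ^ l`. -/
theorem floor_rpow_mul_layer_le (hr : 0 < r) (hu : 0 < u) {θ : ℝ} (hθ : 0 ≤ θ) (a s : ℝ)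
    (N l : ℕ) :
    (⌊u * r ^ l⌋₊ + 1 : ℝ) ^ (-θ) *
        ((2 : ℝ) ^ (-a * (N + l : ℕ)) * max ((N + l : ℕ) : ℝ) 1 ^ s) ≤
      u ^ (-θ) * ((2 : ℝ) ^ (-a * N) * (N + 1 : ℝ) ^ s) *
        ((r ^ (-θ) * 2 ^ (-a)) ^ l * (l + 2 : ℝ) ^ |s|) := by
  have hfloor : (⌊u * r ^ l⌋₊ + 1 : ℝ) ^ (-θ) ≤ u ^ (-θ) * (r ^ (-θ)) ^ l := by
    rw [← Real.rpow_mul_natCast hr.le, mul_comm (-θ), Real.rpow_natCast_mul hr.le,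
      ← Real.mul_rpow hu.le (by positivity)]
    exact Real.rpow_le_rpow_of_nonpos (by positivity) (Nat.lt_floor_add_one _).le (by linarith)
  have htwo : (2 : ℝ) ^ (-a * (N + l : ℕ)) = 2 ^ (-a * N) * (2 ^ (-a)) ^ l := by
    rw [Nat.cast_add, mul_add, Real.rpow_add two_pos,
      Real.rpow_mul_natCast zero_le_two (-a) l]
  calc _ ≤ u ^ (-θ) * (r ^ (-θ)) ^ l *
        ((2 : ℝ) ^ (-a * (N + l : ℕ)) * ((N + 1 : ℝ) ^ s * (l + 2 : ℝ) ^ |s|)) := by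
        gcongr
        exact max_add_one_rpow_le N l s
    _ = _ := by
        rw [htwo, mul_pow]
        ring

end Ratio

end Parameters

section Assembly

variable {v m : ℕ}

theorem card_hyperbolicCross_le_pow {N : ℕ} (hv : 1 ≤ v) (hN : 2 ^ N ≤ v) (d m : ℕ) :
    (hyperbolicCross d (N + m * Nat.clog 2 v)).card ≤ v ^ ((2 * m + 1) * d) := by
  have hclog : 2 ^ Nat.clog 2 v ≤ v ^ 2 := by
    rcases hv.eq_or_lt with rfl | hv
    · simp
    have hpred := Nat.pow_pred_clog_lt_self one_lt_two hv
    have hpos : Nat.clog 2 v ≠ 0 := (Nat.clog_pos one_lt_two hv).ne'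
    rw [← Nat.succ_pred hpos, pow_succ, sq]
    exact Nat.mul_le_mul hpred.le hv
  calc (hyperbolicCross d (N + m * Nat.clog 2 v)).card
      ≤ 2 ^ ((N + m * Nat.clog 2 v) * d) := card_hyperbolicCross_le _ _
    _ = (2 ^ N * (2 ^ Nat.clog 2 v) ^ m) ^ d := by rw [pow_mul, pow_add, mul_comm m, pow_mul 2]
    _ ≤ (v * (v ^ 2) ^ m) ^ d := by gcongr
    _ = v ^ ((2 * m + 1) * d) := by rw [← pow_mul, ← pow_succ', ← pow_mul]

theorem sum_select_add_iterate_le {r : ℝ} (hr : 0 < r) (hr1 : r < 1) {e N : ℕ}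
    (hN : 2 * ((2 ^ N - 1) * N ^ e) ≤ v) {L : ℕ} {S : GreedyScheme (Fin (e + 1) → ℤ)}
    (hS : S = hyperbolicScheme (e + 1) N L fun l => ⌊(1 - r) / 4 * v * r ^ l⌋₊) :
    ∑ j, (S.select j + S.iterate j) ≤ v := by
  have hkept := (Nat.mul_le_mul_left 2 (sum_card_hyperbolicLayer_le e N)).trans hN
  have hu : 0 ≤ (1 - r) / 4 * v := mul_nonneg (by linarith) v.cast_nonneg
  have hgreedy : 4 * ∑ l ∈ Finset.range L, ⌊(1 - r) / 4 * v * r ^ l⌋₊ ≤ v := by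
    have hsum := sum_floor_geometric_le hr hr1 hu L
    have hquarter : (1 - r) / 4 * v / (1 - r) = v / 4 := by
      field_simp [(sub_pos.2 hr1).ne']
    rw [hquarter, le_div_iff₀' four_pos] at hsum
    exact_mod_cast hsum
  rw [hS, sum_select_add_iterate_hyperbolicScheme]
  omega

/-- The constant `C` of the error bound, for weights `a`, `b`, dimension `e + 1` and a space of
smoothness power `q` with constant `K`, when `t * v * r ^ l` is the budget of the layer `N + l`. -/
noncomputable def greedyErrorConst (e : ℕ) (a b β q K r t : ℝ) : ℝ :=
  K ^ (1 / q) * t ^ (-(1 / β - 1 / q)) * (4 ^ a * (e + 3 : ℝ) ^ |e * (a + b)|) *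
    ∑' l : ℕ, (r ^ (-(1 / β - 1 / q)) * 2 ^ (-a)) ^ l * (l + 2 : ℝ) ^ |e * b|

theorem greedyErrorConst_pos {e : ℕ} {a b β q K r t : ℝ} (hK : 0 < K) (hr : 0 < r) (ht : 0 < t)
    (hρ : r ^ (-(1 / β - 1 / q)) * 2 ^ (-a) < 1) : 0 < greedyErrorConst e a b β q K r t := by
  have hsum := (summable_pow_mul_rpow (by positivity) hρ |e * b|).tsum_pos
    (fun l => by positivity) 0 (by positivity)
  rw [greedyErrorConst]
  positivity

variable {d N L : ℕ} {Ω : Type*} [TopologicalSpace Ω] [CompactSpace Ω] [MeasurableSpace Ω]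
  [BorelSpace Ω] {p : ℝ≥0∞} [Fact (1 ≤ p)] {ν : Measure Ω} [IsProbabilityMeasure ν]
  {a b β : ℝ} {ψ : (Fin d → ℤ) → C(Ω, ℂ)} {f : C(Ω, ℂ)} {c : (Fin d → ℤ) → ℂ}
  {h : (Fin d → ℤ) →₀ ℂ}

theorem IsWRepresentation.norm_toLp_sub_le (hc : IsWRepresentation a b β ψ f c) {q K : ℝ}
    (hX : IsPowerSmooth q K (Lp ℂ p ν)) (hq : 1 < q) (hq2 : q ≤ 2) (hK : 1 ≤ K) (hβ : 0 < β)
    (hβ' : β ≤ 1) (hψ : ∀ k, ‖ψ k‖ ≤ 1) {r u : ℝ} (hr : 0 < r) (hu : 0 < u)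
    (hρ : r ^ (-(1 / β - 1 / q)) * 2 ^ (-a) < 1) (hn : ∀ l, L ≤ l → ⌊u * r ^ l⌋₊ = 0)
    (H : (hyperbolicScheme d N L fun l => ⌊u * r ^ l⌋₊).IsOutput p ν ψ c h) :
    ‖ContinuousMap.toLp p ν ℂ (f - Finsupp.linearCombination ℂ ψ h)‖ ≤
      K ^ (1 / q) * (u ^ (-(1 / β - 1 / q)) *
        ((2 : ℝ) ^ (-a * N) * (N + 1 : ℝ) ^ (((d : ℝ) - 1) * b))) *
        ∑' l : ℕ, (r ^ (-(1 / β - 1 / q)) * 2 ^ (-a)) ^ l * (l + 2 : ℝ) ^ |((d : ℝ) - 1) * b| := by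
  have hθ : 0 ≤ 1 / β - 1 / q := sub_nonneg.2 (one_div_le_one_div_of_le hβ (hβ'.trans hq.le))
  have hsum := summable_pow_mul_rpow (by positivity) hρ |((d : ℝ) - 1) * b|
  rw [← tsum_mul_left]
  refine norm_toLp_sub_le_of_isOutput_hyperbolicScheme hX hq hq2 hK hβ hβ' hc.hasSum hc.summable hψ
    hn (hsum.mul_left _) (fun l => ?_) H
  calc K ^ (1 / q) * (⌊u * r ^ l⌋₊ + 1 : ℝ) ^ (1 / q - 1 / β) *
        coeffQuasiNorm β (hyperbolicLayer d (N + l)) c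
      ≤ K ^ (1 / q) * ((⌊u * r ^ l⌋₊ + 1 : ℝ) ^ (-(1 / β - 1 / q)) *
        ((2 : ℝ) ^ (-a * (N + l : ℕ)) * max ((N + l : ℕ) : ℝ) 1 ^ (((d : ℝ) - 1) * b))) := by
        rw [neg_sub, mul_assoc]
        gcongr
        exact hc.layer_le (N + l)
    _ ≤ _ := (mul_le_mul_of_nonneg_left (floor_rpow_mul_layer_le hr hu hθ a _ N l)
        (by positivity)).trans_eq (mul_assoc _ _ _).symm

theorem IsWRepresentation.norm_toLp_sub_le_log {e : ℕ} {ψ : (Fin (e + 1) → ℤ) → C(Ω, ℂ)}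
    {c : (Fin (e + 1) → ℤ) → ℂ} {h : (Fin (e + 1) → ℤ) →₀ ℂ}
    (hc : IsWRepresentation a b β ψ f c) {q K : ℝ} (hX : IsPowerSmooth q K (Lp ℂ p ν))
    (hq : 1 < q) (hq2 : q ≤ 2) (hK : 1 ≤ K) (ha : 0 ≤ a) (hβ : 0 < β) (hβ' : β ≤ 1)
    (hψ : ∀ k, ‖ψ k‖ ≤ 1) {r t : ℝ} (hr : 0 < r) (ht : 0 < t)
    (hρ : r ^ (-(1 / β - 1 / q)) * 2 ^ (-a) < 1) (hv : 1 ≤ v) (hN : 2 ^ N ≤ v)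
    (hvN : v ≤ 4 * (2 ^ N * (N + 1) ^ e)) (hn : ∀ l, L ≤ l → ⌊t * v * r ^ l⌋₊ = 0)
    (H : (hyperbolicScheme (e + 1) N L fun l => ⌊t * v * r ^ l⌋₊).IsOutput p ν ψ c h) :
    ‖ContinuousMap.toLp p ν ℂ (f - Finsupp.linearCombination ℂ ψ h)‖ ≤
      greedyErrorConst e a b β q K r t * (v : ℝ) ^ (-a + 1 / q - 1 / β) *
        Real.log (2 * v) ^ (e * (a + b)) := by
  have hv0 : (0 : ℝ) < v := Nat.cast_pos.2 hv
  have herror := hc.norm_toLp_sub_le hX hq hq2 hK hβ hβ' hψ hr (mul_pos ht hv0) hρ hn H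
  have hexp : -a + 1 / q - 1 / β = -(1 / β - 1 / q) + -a := by ring
  rw [Nat.cast_succ, add_sub_cancel_right, Real.mul_rpow ht.le hv0.le] at herror
  rw [greedyErrorConst, hexp, Real.rpow_add hv0]
  set S := ∑' l : ℕ, (r ^ (-(1 / β - 1 / q)) * 2 ^ (-a)) ^ l * (l + 2 : ℝ) ^ |e * b|
  have hS : 0 ≤ S := tsum_nonneg fun l => by positivity
  refine herror.trans ((mul_le_mul_of_nonneg_right (mul_le_mul_of_nonneg_left
    (mul_le_mul_of_nonneg_left (two_rpow_mul_level_rpow_le hv hN hvN ha b)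
      (by positivity)) (by positivity)) hS).trans_eq (by ring))

theorem lemma5p2_general (d : ℕ) (hd : 1 ≤ d) (p : ℝ≥0∞) [Fact (1 ≤ p)] (hp : 1 < p) (hp' : p ≠ ∞)
    (a β : ℝ) (ha : 0 < a) (hβ : 0 < β) (hβ' : β ≤ 1) :
    ∃ (cstar : ℝ) (Q : ℕ → Finset (Fin d → ℤ)) (S : ℕ → GreedyScheme (Fin d → ℤ)),
      0 < cstar ∧ (∀ v, 1 ≤ v → ((Q v).card : ℝ) ≤ (v : ℝ) ^ cstar) ∧
      ∀ b : ℝ, ∃ C : ℝ, 0 < C ∧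
        ∀ (Ω : Type*) [TopologicalSpace Ω] [CompactSpace Ω] [MeasurableSpace Ω] [BorelSpace Ω]
          (ψ : (Fin d → ℤ) → C(Ω, ℂ)), (∀ k x, ‖ψ k x‖ ≤ 1) →
        ∀ v : ℕ, 1 ≤ v → ∀ (ν : Measure Ω) [IsProbabilityMeasure ν] (f : C(Ω, ℂ)) c,
          IsWRepresentation a b β ψ f c →
          (∃ h, (S v).IsOutput p ν ψ c h) ∧
          ∀ h, (S v).IsOutput p ν ψ c h →
            h.support ⊆ Q v ∧ h.support.card ≤ v ∧
            ‖ContinuousMap.toLp p ν ℂ (f - Finsupp.linearCombination ℂ ψ h)‖ ≤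
              C * (v : ℝ) ^ (-a + 1 / min p.toReal 2 - 1 / β) *
                (Real.log (2 * (v : ℝ))) ^ (((d : ℝ) - 1) * (a + b)) := by
  obtain ⟨e, rfl⟩ := Nat.exists_eq_add_of_le' hd
  have hp1 : 1 < p.toReal := by simpa using ENNReal.toReal_strict_mono hp' hp
  have hq : 1 < min p.toReal 2 := lt_min hp1 one_lt_two
  have hK : 1 ≤ smoothnessConst p.toReal :=
    one_le_two.trans (two_le_smoothnessConst (zero_le_one.trans hp1.le))
  obtain ⟨r, hr, hr1, hρ⟩ := exists_ratio ha
    (sub_pos.2 (one_div_lt_one_div_of_lt hβ (hβ'.trans_lt hq)))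
  obtain ⟨m, hm⟩ := exists_pow_lt_of_lt_one (one_half_pos (α := ℝ)) hr1
  choose! N hkept hN hvN using fun v (hv : 1 ≤ v) => exists_level e hv
  have ht : 0 < (1 - r) / 4 := by linarith
  refine ⟨((2 * m + 1) * (e + 1) : ℕ), fun v => hyperbolicCross (e + 1) (N v + m * Nat.clog 2 v),
    fun v => hyperbolicScheme (e + 1) (N v) (m * Nat.clog 2 v)
      fun l => ⌊(1 - r) / 4 * v * r ^ l⌋₊, by positivity, fun v hv => ?_, fun b => ?_⟩
  · exact_mod_cast card_hyperbolicCross_le_pow hv (hN v hv) (e + 1) m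
  refine ⟨_, greedyErrorConst_pos (e := e) (b := b) (zero_lt_one.trans_le hK) hr ht hρ,
    fun Ω _ _ _ _ ψ hψ v hv ν _ f c hc => ⟨GreedyScheme.exists_isOutput fun j =>
      hyperbolicLayer_nonempty hd _, fun h H => ⟨?_, ?_, ?_⟩⟩⟩
  · exact H.support_subset.1.trans_eq biUnion_block_hyperbolicScheme
  · exact H.support_subset.2.trans (sum_select_add_iterate_le hr hr1 (hkept v hv) rfl)
  · rw [Nat.cast_succ, add_sub_cancel_right]
    have hu : (1 - r) / 4 * v < v := mul_lt_of_lt_one_left (Nat.cast_pos.2 hv) (by linarith)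
    exact hc.norm_toLp_sub_le_log (isPowerSmooth_Lp hp') hq (min_le_right _ _) hK ha.le hβ hβ'
      (fun k => (ContinuousMap.norm_le _ zero_le_one).2 (hψ k)) hr ht hρ hv (hN v hv) (hvN v hv)
      (fun l hl => floor_mul_pow_eq_zero hr hr1 hm.le hl hu) H

end Assembly

theorem lemma5p2 (d : ℕ) (hd : 1 ≤ d) (p : ℝ≥0∞) [Fact (1 ≤ p)] (hp : 1 < p) (hp' : p ≠ ∞)
    (a β : ℝ) (ha : 0 < a) (hβ : 0 < β) (hβ' : β ≤ 1) :
    ∃ cstar : ℝ, 0 < cstar ∧ ∀ b : ℝ, ∃ C : ℝ, 0 < C ∧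
      ∀ (N : ℕ) (Ω : Set (EuclideanSpace ℝ (Fin N))) [CompactSpace Ω]
        (ψ : (Fin d → ℤ) → C(Ω, ℂ)), (∀ k x, ‖ψ k x‖ ≤ 1) →
      ∀ v : ℕ, 1 ≤ v →
      ∃ Q : Finset (Fin d → ℤ), (Q.card : ℝ) ≤ (v : ℝ) ^ cstar ∧
        ∀ (μ : Measure Ω) [IsProbabilityMeasure μ] (m : ℕ) (ξ : Fin m → Ω), 0 < m →
        ∃ S : GreedyScheme (Fin d → ℤ),
          ∀ f ∈ WClass a b β ψ, ∀ c, IsWRepresentation a b β ψ f c →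
            (∃ h, S.IsOutput p (measureXi μ ξ) ψ c h) ∧
            ∀ h, S.IsOutput p (measureXi μ ξ) ψ c h →
              h.support ⊆ Q ∧ h.support.card ≤ v ∧
              ‖ContinuousMap.toLp p (measureXi μ ξ) ℂ
                  (f - Finsupp.linearCombination ℂ ψ h)‖ ≤
                C * (v : ℝ) ^ (-a + 1 / min p.toReal 2 - 1 / β) *
                  (Real.log (2 * (v : ℝ))) ^ (((d : ℝ) - 1) * (a + b)) := by
  obtain ⟨cstar, Q, S, hcstar, hQ, H⟩ := lemma5p2_general d hd p hp hp' a β ha hβ hβ'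
  refine ⟨cstar, hcstar, fun b => ?_⟩
  obtain ⟨C, hC, H⟩ := H b
  refine ⟨C, hC, fun _ Ω _ ψ hψ v hv => ⟨Q v, hQ v hv, fun μ _ m ξ hm => ?_⟩⟩
  have := isProbabilityMeasure_measureXi μ hm ξ
  exact ⟨S v, fun f _ c hc => H Ω ψ hψ v hv (measureXi μ ξ) f c hc⟩
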